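/- Let $T$ be the $\mathrm{PGW}_\infty(1)$ tree (a Galton–Watson tree with Poisson$(1)$ offspring, conditioned on non-extinction): start with an infinite path with vertices $1,2,3,\ldots$ and edges directed from $n+1$ to $n$; to every $n$ attach an independent Galton–Watson tree with Poisson$(1)$ offspring distribution, rooted at $n$, with edges directed towards $n$; root the resulting tree at $\rho=1$. Let $\alpha \ge 0$ and let independent Poisson$(\alpha)$ numbers of cars arrive at the vertices of $T$, independently of $T$. Every vertex has room for one car. The cars arrive one by one; a car drives from its arrival vertex towards $\rho$ and parks at the first unoccupied vertex that it meets (possibly the arrival vertex itself), and leaves the tree if there is none. Let $A_\alpha$ be the event that all the cars can park on $T$, i.e. that no car leaves the tree, whatever the order of arrival. Then \[ \mathbb{P}(A_\alpha)=\begin{cases}\dfrac{\sqrt{1-2\alpha}}{1-\alpha} & \text{if } 0\le\alpha\le 1/2,\\[1ex] 0 & \text{if } \alpha>1/2.\end{cases} \] -/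

import Mathlib

open MeasureTheory ProbabilityTheory
open scoped NNReal ENNReal

namespace SpineParking

/-- The family tree in which the individual `w` has `k w` children, as a set of Ulam–Harris words.
Words are written with the most recent generation first: the progenitor is `[]` and the children of
`w` are `i :: w` for `i < k w`. If the `k w` are i.i.d. with law `ν`, this is the Galton–Watson tree
with offspring distribution `ν`. -/
def familyTree (k : List ℕ → ℕ) : List ℕ → Prop
  | [] => True
  | i :: w => familyTree k w ∧ i < k w

/-- Labels of vertices: `(n, w)` is the individual `w` of the family tree attached at the `n`-th
vertex of the infinite path (the spine), and `(n, [])` is that spine vertex itself. The spine is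
numbered from `0`, so the root is `(0, [])`. -/
abbrev Vertex : Type := ℕ × List ℕ

/-- The vertex set of the infinite tree made of the spine with a family tree rooted at every spine
vertex, where `N (n, w)` is the number of children of `w` in the family tree attached at `n`. -/
def spineTree (N : Vertex → ℕ) : Set Vertex :=
  {v | familyTree (fun w => N (v.1, w)) v.2}

/-- The neighbour of a vertex in the direction of the root (`none` for the root): edges point from
`n + 1` to `n` along the spine, and from child to parent inside the attached trees. -/
def next : Vertex → Option Vertex
  | (0, []) => none
  | (n + 1, []) => some (n, [])
  | (n, _ :: w) => some (n, w)

/-- The successive vertices met when driving from `v` to the root, both ends included. -/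
def route (v : Vertex) : List Vertex :=
  match _h : next v with
  | none => [v]
  | some u => v :: route u
termination_by v.1 + v.2.length
decreasing_by
  obtain ⟨n, w⟩ := v
  cases w with
  | nil =>
    cases n with
    | zero => simp [next] at _h
    | succ n => simp only [next, Option.some.injEq] at _h; subst _h; simp
  | cons i w => simp only [next, Option.some.injEq] at _h; subst _h; simp

/-- The place where a car that arrives at `v` parks if the vertices in `occ` are occupied: the first
free vertex on its way to the root; `none` if there is none, in which case the car leaves. -/
def parkingSpot (occ : Finset Vertex) (v : Vertex) : Option Vertex :=
  (route v).find? fun u => decide (u ∉ occ)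

/-- Starting with the vertices in `occ` occupied, cars arrive one by one at the vertices of the
given list, in that order; every one of them finds a place (none leaves the tree). -/
def AllFindSpot : Finset Vertex → List Vertex → Prop
  | _, [] => True
  | occ, v :: l => ∃ u, parkingSpot occ v = some u ∧ AllFindSpot (insert u occ) l

/-- All cars can park on the tree given by `N` when `P v` cars arrive at each vertex `v` of it.
There may be infinitely many cars, arriving one by one in some order. A finite list of arrivals
using at most `P v` cars at each vertex `v` of the tree and no others is the same as an
initial stretch of an order of arrival of all the cars; so this says that, whatever the order
of arrival, no car ever leaves the tree. -/
def AllCarsPark (N P : Vertex → ℕ) : Prop :=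
  ∀ l : List Vertex, (∀ v ∈ l, v ∈ spineTree N) → (∀ v, l.count v ≤ P v) → AllFindSpot ∅ l

end SpineParking

/-!
Whether all cars can park does not depend on the order of arrival: by a Hall-type argument
(`allCarsPark_iff_rootClosed`) parking fails exactly if some finite set of vertices closed towards the
root receives more cars than it has vertices. Optimising over such sets from the leaves of the
attached trees downwards gives the flux recursion `X = P + ∑ (X_child - 1)⁺` for the number `X` of
cars that reach a vertex from its family tree, and all cars can park if and only if, for every
truncation height `h`, the random walk along the spine with steps `X h k - 1` never becomes
positive (`allCarsPark_iff_flux`). The fluxes `X h k` at the spine vertices `k` are independent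
with a common law, so for a fixed `h` the probability of this event is `(1 - m)⁺ / p`, where `m`
is the mean of the flux and `p` its probability of being `0` (`measureReal_stayBelow_zero`). The
event decreases with `h`, so it remains to find the limits of `m = m h` and `p = p h`. Working at
finite heights means that all moments are finite and that neither the almost sure finiteness of
the trees nor that of the untruncated flux is ever needed.

The flux at height `h + 1` is a compound Poisson sum of copies of `(X h - 1)⁺`, whence recursions
for the mean, the second factorial moment `q h` and the generating function (section on compound
Poisson sums, collected in `IsPoissonField.fluxMoments`). In particular `m (h + 1) = m h + α - 1 +
p h` and `q (h + 1) - q h = m (h + 1) ^ 2 - 2 * m (h + 1) + 2 * α`. As `q` increases, `m h` can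
never lie strictly between the roots `1 ± √(1 - 2α)` of this quadratic, and an interpolation
between consecutive heights shows that it cannot jump over the gap either
(`FluxMoments.m_le_root`), so `m` stays below the smaller root if `α < 1/2`. On the other hand, if
`m` stays bounded, then `p h` tends to `1 - α`, and expanding the equation of the limiting
generating function at `1` shows that the limit of `m` is a root
(`FluxMoments.quadratic_eq_zero`). Thus `m` tends to `1 - √(1 - 2α)` for `α < 1/2`; for `α = 1/2`
it tends to `1` or to infinity, and for `α > 1/2`, when there is no real root, to infinity. In the
last two cases `(1 - m)⁺` tends to `0`.
-/

namespace SpineParking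

/-! ### Parking and root-closed sets -/

theorem route_of_next_none {v : Vertex} (h : next v = none) : route v = [v] := by
  rw [route]; split <;> simp_all

theorem route_of_next_some {v u : Vertex} (h : next v = some u) : route v = v :: route u := by
  rw [route]; split <;> simp_all

theorem self_mem_route (v : Vertex) : v ∈ route v := by
  cases h : next v with
  | none => simp [route_of_next_none h]
  | some u => simp [route_of_next_some h]

/-- Induction along the way to the root. -/
theorem next_induction {motive : Vertex → Prop} (root : ∀ v, next v = none → motive v)
    (step : ∀ v u, next v = some u → motive u → motive v) (v : Vertex) : motive v := by
  obtain ⟨n, w⟩ := v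
  have key : ∀ n, motive (n, []) := by
    intro n
    induction n with
    | zero => exact root _ rfl
    | succ n ih => exact step _ _ rfl ih
  induction w with
  | nil => exact key n
  | cons i w ih => exact step _ (n, w) (by cases n <;> rfl) ih

/-- A finite set of vertices that contains, with each vertex, the whole way from it to the root. -/
def RootClosed (C : Finset Vertex) : Prop :=
  ∀ v ∈ C, ∀ u, next v = some u → u ∈ C

theorem RootClosed.mem_of_mem_route {C : Finset Vertex} (hC : RootClosed C) (v : Vertex) :
    v ∈ C → ∀ u ∈ route v, u ∈ C := by
  induction v using next_induction with
  | root v h => intro hv u hu; simp_all [route_of_next_none h]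
  | step v x h ih =>
    intro hv u hu
    rw [route_of_next_some h, List.mem_cons] at hu
    rcases hu with rfl | hu
    · exact hv
    · exact ih (hC _ hv _ h) u hu

/-- If all cars find a spot, then a root-closed set has enough free places for the cars that arrive
in it, since these cars can only park in it. -/
theorem AllFindSpot.countP_le {C : Finset Vertex} (hC : RootClosed C) (l : List Vertex) :
    ∀ occ, AllFindSpot occ l → l.countP (· ∈ C) ≤ (C \ occ).card := by
  induction l with
  | nil => simp
  | cons v l ih =>
    rintro occ ⟨u, hu, hl⟩
    have h1 := ih _ hl
    have hmem : u ∈ route v := List.mem_of_find?_eq_some hu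
    have hocc : u ∉ occ := by simpa using List.find?_some hu
    rw [List.countP_cons]
    split_ifs with hv
    · have huC : u ∈ C := hC.mem_of_mem_route v (by simpa using hv) u hmem
      have : (C \ insert u occ).card < (C \ occ).card := by
        apply Finset.card_lt_card
        refine ⟨Finset.sdiff_subset_sdiff le_rfl (Finset.subset_insert _ _), fun h => ?_⟩
        have := h (Finset.mem_sdiff.2 ⟨huC, hocc⟩)
        simp at this
      omega
    · have : (C \ insert u occ).card ≤ (C \ occ).card :=
        Finset.card_le_card (Finset.sdiff_subset_sdiff le_rfl (Finset.subset_insert _ _))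
      omega

/-- A car that arrives at `v` and parks at `u` drives through occupied vertices only. -/
theorem reflTransGen_of_parkingSpot {occ : Finset Vertex} {u : Vertex} (v : Vertex) :
    parkingSpot occ v = some u →
      Relation.ReflTransGen (fun a b => next a = some b ∧ a ∈ occ) v u := by
  induction v using next_induction with
  | root v h =>
    intro hu
    have := List.mem_of_find?_eq_some hu
    rw [route_of_next_none h, List.mem_singleton] at this
    rw [this]
  | step v x h ih =>
    intro hu
    rw [parkingSpot, route_of_next_some h, List.find?_cons] at hu
    by_cases hv : v ∈ occ
    · simp only [hv, not_true_eq_false, decide_false] at hu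
      exact Relation.ReflTransGen.head ⟨h, hv⟩ (ih hu)
    · simp only [hv, not_false_eq_true, decide_true, Option.some.injEq] at hu
      rw [hu]

/-- The list `L` records pairs (arrival vertex, parking place) of the cars parked so far, which
occupy `occ`. If one of the later arrivals `l` finds no place, then at that time the occupied
vertices joined to the root by occupied vertices form a root-closed set, all cars parked in it
arrived in it, and so did the unlucky car. -/
theorem exists_rootClosed_of_not_allFindSpot (l : List Vertex) :
    ∀ (occ : Finset Vertex) (L : List (Vertex × Vertex)), (L.map Prod.snd).Nodup →
      (L.map Prod.snd).toFinset = occ →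
      (∀ x ∈ L, Relation.ReflTransGen (fun a b => next a = some b ∧ a ∈ occ) x.1 x.2) →
      ¬ AllFindSpot occ l →
      ∃ C, RootClosed C ∧ C.card < (L.map Prod.fst).countP (· ∈ C) + l.countP (· ∈ C) := by
  induction l with
  | nil => intro _ _ _ _ _ h; exact (h trivial).elim
  | cons v l ih =>
    intro occ L hnd hL hp hf
    cases hs : parkingSpot occ v with
    | some u =>
      have hocc : u ∉ occ := by simpa using List.find?_some hs
      obtain ⟨C, hC, hlt⟩ := ih (insert u occ) ((v, u) :: L)
        (by
          rw [List.map_cons, List.nodup_cons]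
          exact ⟨fun h => hocc (hL ▸ List.mem_toFinset.2 h), hnd⟩)
        (by rw [List.map_cons, List.toFinset_cons, hL])
        (by
          intro x hx
          have hmono : ∀ a b, (next a = some b ∧ a ∈ occ) → (next a = some b ∧ a ∈ insert u occ) :=
            fun a b h => ⟨h.1, Finset.mem_insert_of_mem h.2⟩
          rcases List.mem_cons.1 hx with rfl | hx
          · exact Relation.ReflTransGen.mono hmono _ _ (reflTransGen_of_parkingSpot v hs)
          · exact Relation.ReflTransGen.mono hmono _ _ (hp x hx))
        (fun h => hf ⟨u, hs, h⟩)
      refine ⟨C, hC, hlt.trans_eq ?_⟩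
      rw [List.map_cons, List.countP_cons, List.countP_cons]
      ring
    | none =>
      classical
      set C := occ.filter (fun x => ∀ y ∈ route x, y ∈ occ) with hCdef
      have hmemC : ∀ x, x ∈ C ↔ ∀ y ∈ route x, y ∈ occ := fun x => by
        rw [hCdef, Finset.mem_filter]
        exact ⟨fun h => h.2, fun h => ⟨h x (self_mem_route x), h⟩⟩
      have hv : v ∈ C := by
        rw [hmemC]
        intro y hy
        have := List.find?_eq_none.1 hs y hy
        simpa using this
      refine ⟨C, ?_, ?_⟩
      · intro x hx u hu
        rw [hmemC] at hx ⊢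
        intro y hy
        exact hx y (by rw [route_of_next_some hu]; exact List.mem_cons_of_mem _ hy)
      · have hcard : C.card = (L.map Prod.snd).countP (· ∈ C) := by
          rw [List.countP_eq_length_filter, ← List.toFinset_card_of_nodup (hnd.filter _),
            List.toFinset_filter, hL]
          congr 1
          ext x
          simp only [Finset.mem_filter, decide_eq_true_eq]
          exact ⟨fun h => ⟨Finset.mem_of_mem_filter x h, h⟩, fun h => h.2⟩
        have hle : (L.map Prod.snd).countP (· ∈ C) ≤ (L.map Prod.fst).countP (· ∈ C) := by
          rw [List.countP_map, List.countP_map]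
          apply List.countP_mono_left
          intro x hx h
          simp only [Function.comp_apply, decide_eq_true_eq] at h ⊢
          refine Relation.ReflTransGen.head_induction_on (hp x hx) h ?_
          intro a b hab _ hb
          rw [hmemC] at hb ⊢
          intro y hy
          rw [route_of_next_some hab.1, List.mem_cons] at hy
          rcases hy with rfl | hy
          · exact hab.2
          · exact hb y hy
        rw [List.countP_cons]
        simp only [hv, decide_true, if_true]
        omega

theorem mem_spineTree_of_next {N : Vertex → ℕ} {v u : Vertex} (h : next v = some u)
    (hv : v ∈ spineTree N) : u ∈ spineTree N := by
  obtain ⟨n, w⟩ := v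
  cases w with
  | nil =>
    cases n with
    | zero => simp [next] at h
    | succ n =>
      obtain rfl : (n, []) = u := by simpa [next] using h
      trivial
  | cons i w =>
    obtain rfl : (n, w) = u := by cases n <;> simpa [next] using h
    exact hv.1

/-- The two equality tests on vertices, componentwise and by decidable equality, count alike. -/
theorem count_eq_count (l : List Vertex) (v : Vertex) :
    l.count v = @List.count Vertex instBEqOfDecidableEq v l := by
  congr 1
  exact lawful_beq_subsingleton _ _

/-- A Hall-type criterion: all cars can park if and only if no finite root-closed part of the tree
receives more cars than it has vertices. -/
theorem allCarsPark_iff_rootClosed (N P : Vertex → ℕ) :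
    AllCarsPark N P ↔
      ∀ C : Finset Vertex, RootClosed C → ↑C ⊆ spineTree N → ∑ v ∈ C, P v ≤ C.card := by
  constructor
  · intro h C hC hCN
    set s : Multiset Vertex := ∑ v ∈ C, Multiset.replicate (P v) v with hs
    have hcount : ∀ v, s.count v = if v ∈ C then P v else 0 := by
      intro v
      simp [hs, Multiset.count_sum', Multiset.count_replicate]
    have hmem : ∀ v ∈ s, v ∈ C := by
      intro v hv
      by_contra hvC
      have := hcount v
      rw [if_neg hvC, Multiset.count_eq_zero] at this
      exact this hv
    have h1 := AllFindSpot.countP_le hC s.toList ∅ (h s.toList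
      (fun v hv => hCN (hmem v (Multiset.mem_toList.1 hv)))
      (fun v => by
        rw [count_eq_count, ← Multiset.coe_count, Multiset.coe_toList, hcount]
        split_ifs <;> simp))
    rw [List.countP_eq_length.2 (fun v hv => by simpa using hmem v (Multiset.mem_toList.1 hv)),
      Multiset.length_toList, Finset.sdiff_empty] at h1
    simpa [hs, Multiset.card_sum] using h1
  · intro h l hl hcount
    by_contra hf
    obtain ⟨C, hC, hlt⟩ := exists_rootClosed_of_not_allFindSpot l ∅ [] (by simp) (by simp)
      (by simp) hf
    classical
    have h1 := h (C.filter (· ∈ spineTree N))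
      (fun v hv u hu => by
        rw [Finset.mem_filter] at hv ⊢
        exact ⟨hC v hv.1 u hu, mem_spineTree_of_next hu hv.2⟩)
      (fun v hv => (Finset.mem_filter.1 hv).2)
    have h2 : l.countP (· ∈ C) ≤ ∑ v ∈ C.filter (· ∈ spineTree N), l.count v := by
      rw [← List.countP_congr (p := (· ∈ C.filter (· ∈ spineTree N)))
        (fun v hv => by simp [hl v hv])]
      rw [List.countP_eq_length_filter, ← Multiset.coe_card,
        ← Multiset.sum_count_eq_card (s := C.filter (· ∈ spineTree N))]
      · apply Finset.sum_le_sum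
        intro v _
        rw [Multiset.coe_count, count_eq_count]
        exact @List.Sublist.count_le Vertex instBEqOfDecidableEq _ _ v List.filter_sublist
      · intro v hv
        simpa using (List.mem_filter.1 hv).2
    have h3 : ∑ v ∈ C.filter (· ∈ spineTree N), l.count v ≤
        ∑ v ∈ C.filter (· ∈ spineTree N), P v := Finset.sum_le_sum fun v _ => hcount v
    have h4 := Finset.card_filter_le C (· ∈ spineTree N)
    simp only [List.map_nil, List.countP_nil, zero_add] at hlt
    omega

/-! ### Truncated fluxes -/

/-- The number of cars that reach the individual `w` of a family tree, those that arrive at `w`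
included, when only the vertices less than `h` generations above `w` (itself included) are taken
into account; `N` and `P` give the numbers of children and of arriving cars. The truncation makes
the definition a recursion and all moments finite. -/
def flux (N P : List ℕ → ℕ) : ℕ → List ℕ → ℕ
  | 0, _ => 0
  | h + 1, w => P w + ∑ i ∈ Finset.range (N w), (flux N P h (i :: w) - 1)

theorem flux_le_flux_succ (N P : List ℕ → ℕ) (h : ℕ) :
    ∀ w, flux N P h w ≤ flux N P (h + 1) w := by
  induction h with
  | zero => intro w; exact Nat.zero_le _
  | succ h ih =>
    intro w
    rw [flux, flux]
    gcongr with i _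
    exact ih _

theorem flux_append (N P : List ℕ → ℕ) (w : List ℕ) (h : ℕ) :
    ∀ u, flux N P h (u ++ w) = flux (fun u => N (u ++ w)) (fun u => P (u ++ w)) h u := by
  induction h with
  | zero => intro u; rfl
  | succ h ih =>
    intro u
    rw [flux, flux]
    congr 1
    refine Finset.sum_congr rfl fun i _ => ?_
    rw [← ih (i :: u), List.cons_append]

/-- The flux at a vertex, truncated at height `h` of the attached trees. -/
def levelFlux (N P : Vertex → ℕ) (h : ℕ) (v : Vertex) : ℕ :=
  flux (fun w => N (v.1, w)) (fun w => P (v.1, w)) (h - v.2.length) v.2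

theorem levelFlux_eq (N P : Vertex → ℕ) (h : ℕ) (v : Vertex) (hv : v.2.length < h) :
    levelFlux N P h v =
      P v + ∑ i ∈ Finset.range (N v), (levelFlux N P h (v.1, i :: v.2) - 1) := by
  obtain ⟨k, hk⟩ : ∃ k, h - v.2.length = k + 1 := ⟨h - v.2.length - 1, by omega⟩
  have hk' : ∀ i : ℕ, h - (i :: v.2).length = k := fun i => by rw [List.length_cons]; omega
  simp only [levelFlux, hk, hk', flux]

theorem length_lt_of_levelFlux_pos {N P : Vertex → ℕ} {h : ℕ} {v : Vertex}
    (hv : 0 < levelFlux N P h v) : v.2.length < h := by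
  by_contra hlt
  rw [levelFlux, Nat.sub_eq_zero_of_le (not_lt.1 hlt), flux] at hv
  exact lt_irrefl _ hv

/-- Sums over the pairs (vertex of `C`, child of it), as sums over the set of these children. -/
theorem sum_children (N : Vertex → ℕ) (C : Finset Vertex) (f : Vertex → ℕ) :
    ∑ v ∈ C, ∑ i ∈ Finset.range (N v), f (v.1, i :: v.2) =
      ∑ u ∈ (C.sigma fun v => Finset.range (N v)).image
        (fun x => ((x.1.1, x.2 :: x.1.2) : Vertex)), f u := by
  rw [Finset.sum_image, Finset.sum_sigma]
  rintro ⟨⟨n, w⟩, i⟩ _ ⟨⟨n', w'⟩, i'⟩ _ h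
  simp only [Prod.mk.injEq, List.cons.injEq] at h
  obtain ⟨rfl, rfl, rfl⟩ := h
  rfl

theorem mem_children {N : Vertex → ℕ} {C : Finset Vertex} {n i : ℕ} {w : List ℕ} :
    (n, i :: w) ∈ (C.sigma fun v => Finset.range (N v)).image
        (fun x => ((x.1.1, x.2 :: x.1.2) : Vertex)) ↔ (n, w) ∈ C ∧ i < N (n, w) := by
  simp only [Finset.mem_image, Finset.mem_sigma, Finset.mem_range, Sigma.exists, Prod.exists,
    Prod.mk.injEq, List.cons.injEq]
  constructor
  · rintro ⟨a, b, c, h, rfl, rfl, rfl⟩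
    exact h
  · intro h
    exact ⟨n, w, i, h, rfl, rfl, rfl⟩

/-- Summing the flux recursion over the vertices of a set. -/
theorem sum_levelFlux (N P : Vertex → ℕ) (h : ℕ) (C : Finset Vertex)
    (hC : ∀ v ∈ C, v.2.length < h) :
    ∑ v ∈ C, levelFlux N P h v = ∑ v ∈ C, P v +
      ∑ v ∈ C, ∑ i ∈ Finset.range (N v), (levelFlux N P h (v.1, i :: v.2) - 1) := by
  rw [← Finset.sum_add_distrib]
  exact Finset.sum_congr rfl fun v hv => levelFlux_eq N P h v (hC v hv)

/-- The first `n` vertices of the spine. -/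
def spineSegment (n : ℕ) : Finset Vertex :=
  (Finset.range n).image (fun k => (k, []))

theorem mem_spineSegment {n : ℕ} {v : Vertex} : v ∈ spineSegment n ↔ v.1 < n ∧ v.2 = [] := by
  obtain ⟨k, w⟩ := v
  simp only [spineSegment, Finset.mem_image, Finset.mem_range, Prod.mk.injEq]
  constructor
  · rintro ⟨a, ha, rfl, rfl⟩
    exact ⟨ha, rfl⟩
  · rintro ⟨h, rfl⟩
    exact ⟨k, h, rfl, rfl⟩

/-- The spine vertices of a root-closed set form an initial segment of the spine. -/
theorem RootClosed.exists_spine {C : Finset Vertex} (hC : RootClosed C) :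
    ∃ n, C.filter (fun v => v.2 = []) = spineSegment n := by
  classical
  have hex : ∃ k, ((k, []) : Vertex) ∉ C := by
    obtain ⟨k, hk⟩ := Infinite.exists_notMem_finset (C.image Prod.fst)
    exact ⟨k, fun h => hk (Finset.mem_image_of_mem _ h)⟩
  refine ⟨Nat.find hex, ?_⟩
  have hdown : ∀ k j, ((k + j, []) : Vertex) ∈ C → ((k, []) : Vertex) ∈ C := by
    intro k j
    induction j with
    | zero => exact id
    | succ j ih => exact fun h => ih (hC _ h _ rfl)
  ext ⟨k, w⟩
  simp only [Finset.mem_filter, mem_spineSegment]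
  constructor
  · rintro ⟨h, rfl⟩
    refine ⟨?_, rfl⟩
    by_contra hlt
    obtain ⟨j, rfl⟩ := Nat.exists_eq_add_of_le (not_lt.1 hlt)
    exact Nat.find_spec hex (hdown _ j h)
  · rintro ⟨ha, rfl⟩
    exact ⟨by simpa using Nat.find_min hex ha, rfl⟩

/-- The individuals of the tree attached at `n` all of whose ancestors up to the spine, they
themselves included, are reached by a car. -/
def Reached (N P : Vertex → ℕ) (h n : ℕ) : List ℕ → Prop
  | [] => True
  | i :: w => Reached N P h n w ∧ i < N (n, w) ∧ 0 < levelFlux N P h (n, i :: w)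

theorem exists_finset_reached (N P : Vertex → ℕ) (h n j : ℕ) :
    ∃ C : Finset Vertex, ∀ v, v ∈ C ↔ v.1 < n ∧ v.2.length < j ∧ Reached N P h v.1 v.2 := by
  classical
  induction j with
  | zero => exact ⟨∅, by simp⟩
  | succ j ih =>
    obtain ⟨C, hC⟩ := ih
    refine ⟨spineSegment n ∪
      ((C.sigma fun v => Finset.range (N v)).image
        (fun x => ((x.1.1, x.2 :: x.1.2) : Vertex))).filter
          (fun v => 0 < levelFlux N P h v), ?_⟩
    rintro ⟨k, w⟩
    cases w with
    | nil => simp [Reached, mem_spineSegment]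
    | cons i w =>
      rw [Finset.mem_union, Finset.mem_filter, mem_children, hC, mem_spineSegment]
      simp only [reduceCtorEq, and_false, false_or,
        Reached, List.length_cons, Nat.succ_lt_succ_iff]
      tauto

/-- All cars can park if and only if, for all `n` and all truncation heights, at most `n` cars reach
the first `n` vertices of the spine from the trees attached there. -/
theorem allCarsPark_iff_flux (N P : Vertex → ℕ) :
    AllCarsPark N P ↔ ∀ h n, ∑ k ∈ Finset.range n,
      flux (fun w => N (k, w)) (fun w => P (k, w)) h [] ≤ n := by
  have hspine : ∀ h n, ∑ k ∈ Finset.range n, flux (fun w => N (k, w)) (fun w => P (k, w)) h [] =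
      ∑ v ∈ spineSegment n, levelFlux N P h v := by
    intro h n
    rw [spineSegment, Finset.sum_image (by simp)]
    rfl
  have hcard : ∀ n, (spineSegment n).card = n := by
    intro n
    rw [spineSegment, Finset.card_image_of_injective _ (fun a b hab => by simpa using hab),
      Finset.card_range]
  have hsplit : ∀ (C : Finset Vertex) (f : Vertex → ℕ), ∑ v ∈ C, f v =
      ∑ v ∈ C.filter (fun v => v.2 = []), f v + ∑ v ∈ C.filter (fun v => ¬ v.2 = []), f v :=
    fun C f => (Finset.sum_filter_add_sum_filter_not C _ f).symm
  have hcardsplit : ∀ (C : Finset Vertex), C.card =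
      (C.filter (fun v => v.2 = [])).card + (C.filter (fun v => ¬ v.2 = [])).card :=
    fun C => (Finset.card_filter_add_card_filter_not _).symm
  rw [allCarsPark_iff_rootClosed]
  constructor
  · intro H h n
    rcases Nat.eq_zero_or_pos h with rfl | hpos
    · simp [flux]
    obtain ⟨C, hC⟩ := exists_finset_reached N P h n h
    have hroot : RootClosed C := by
      rintro ⟨k, w⟩ hv u hu
      rw [hC] at hv ⊢
      cases w with
      | nil =>
        cases k with
        | zero => simp [next] at hu
        | succ k =>
          obtain rfl : (k, []) = u := by simpa [next] using hu
          exact ⟨(Nat.lt_succ_self k).trans hv.1, hpos, trivial⟩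
      | cons i w =>
        obtain rfl : (k, w) = u := by cases k <;> simpa [next] using hu
        exact ⟨hv.1, (Nat.lt_succ_self _).trans hv.2.1, hv.2.2.1⟩
    have htree : ↑C ⊆ spineTree N := by
      rintro ⟨k, w⟩ hv
      have hr := ((hC _).1 hv).2.2
      clear hv
      change familyTree (fun w => N (k, w)) w
      induction w with
      | nil => trivial
      | cons i w ih => exact ⟨ih hr.1, hr.2.1⟩
    have hS : C.filter (fun v => v.2 = []) = spineSegment n := by
      ext ⟨k, w⟩
      rw [Finset.mem_filter, hC, mem_spineSegment]
      constructor
      · rintro ⟨h1, rfl⟩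
        exact ⟨h1.1, rfl⟩
      · rintro ⟨ha, rfl⟩
        exact ⟨⟨ha, hpos, trivial⟩, rfl⟩
    have h1 := H C hroot htree
    have h2 := sum_levelFlux N P h C (fun v hv => ((hC v).1 hv).2.1)
    have h3 : ∑ v ∈ C, ∑ i ∈ Finset.range (N v), (levelFlux N P h (v.1, i :: v.2) - 1) ≤
        ∑ v ∈ C.filter (fun v => ¬ v.2 = []), (levelFlux N P h v - 1) := by
      rw [sum_children N C (fun u => levelFlux N P h u - 1)]
      apply Finset.sum_le_sum_of_ne_zero
      rintro ⟨k, w⟩ hu hne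
      cases w with
      | nil => simp at hu
      | cons i w =>
        rw [mem_children, hC] at hu
        have hp : 0 < levelFlux N P h (k, i :: w) := by omega
        rw [Finset.mem_filter, hC]
        exact ⟨⟨hu.1.1, length_lt_of_levelFlux_pos hp, hu.1.2.2, hu.2, hp⟩, by simp⟩
    have h4 : ∑ v ∈ C.filter (fun v => ¬ v.2 = []), levelFlux N P h v =
        ∑ v ∈ C.filter (fun v => ¬ v.2 = []), (levelFlux N P h v - 1) +
          (C.filter (fun v => ¬ v.2 = [])).card := by
      rw [Finset.card_eq_sum_ones, ← Finset.sum_add_distrib]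
      refine Finset.sum_congr rfl ?_
      rintro ⟨k, w⟩ hv
      rw [Finset.mem_filter, hC] at hv
      cases w with
      | nil => simp at hv
      | cons i w =>
        have := hv.1.2.2.2.2
        dsimp only at this ⊢
        omega
    rw [hsplit C, hS] at h2
    have h5 := hcardsplit C
    rw [hS, hcard] at h5
    rw [hspine]
    omega
  · intro H C hroot htree
    obtain ⟨n, hn⟩ := hroot.exists_spine
    obtain ⟨h, hh⟩ : ∃ h, ∀ v ∈ C, v.2.length < h :=
      ⟨C.sup (fun v => v.2.length) + 1, fun v hv =>
        Nat.lt_succ_of_le (Finset.le_sup (f := fun v : Vertex => v.2.length) hv)⟩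
    have h2 := sum_levelFlux N P h C hh
    have h3 : ∑ v ∈ C.filter (fun v => ¬ v.2 = []), (levelFlux N P h v - 1) ≤
        ∑ v ∈ C, ∑ i ∈ Finset.range (N v), (levelFlux N P h (v.1, i :: v.2) - 1) := by
      rw [sum_children N C (fun u => levelFlux N P h u - 1)]
      apply Finset.sum_le_sum_of_subset
      rintro ⟨k, w⟩ hu
      rw [Finset.mem_filter] at hu
      cases w with
      | nil => simp at hu
      | cons i w =>
        rw [mem_children]
        exact ⟨hroot _ hu.1 _ (by cases k <;> rfl), (htree hu.1).2⟩
    have h4 : ∑ v ∈ C.filter (fun v => ¬ v.2 = []), levelFlux N P h v ≤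
        ∑ v ∈ C.filter (fun v => ¬ v.2 = []), (levelFlux N P h v - 1) +
          (C.filter (fun v => ¬ v.2 = [])).card := by
      rw [Finset.card_eq_sum_ones, ← Finset.sum_add_distrib]
      exact Finset.sum_le_sum fun v _ => by omega
    have h1 := H h n
    rw [hspine, ← hn] at h1
    have h5 := hcardsplit C
    rw [hn, hcard] at h5
    rw [hsplit C] at h2
    omega

/-! ### Independence and laws of the fluxes -/

/-- Grouping independent variables into disjoint blocks gives independent blocks. The blocks may be
infinite. -/
theorem iIndepFun_fiber {ι κ Ω : Type*} [MeasurableSpace Ω] {μ : Measure Ω}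
    {f : ι → Ω → ℕ} (hf : ∀ i, Measurable (f i)) (h : iIndepFun f μ) (b : ι → κ) :
    iIndepFun (fun (k : κ) (ω : Ω) (i : {i // b i = k}) => f i ω) μ := by
  have := h.isProbabilityMeasure
  have hp : ∀ i, IsProbabilityMeasure (μ.map (f i)) :=
    fun i => Measure.isProbabilityMeasure_map (hf i).aemeasurable
  let X : (k : κ) → {i // b i = k} → Type := fun _ _ => ℕ
  have h' : iIndepFun (fun (p : Σ k, {i // b i = k}) => f p.2) μ :=
    h.precomp (g := fun p : (Σ k, {i // b i = k}) => (p.2 : ι))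
      (Equiv.sigmaFiberEquiv b).injective
  have hcurry : (MeasurableEquiv.piCurry X) ∘
      (fun ω (p : Σ k, {i // b i = k}) => f p.2 ω) =
        fun ω k (i : {i // b i = k}) => f i ω := by
    ext; rfl
  rw [iIndepFun_iff_map_fun_eq_infinitePi_map (by fun_prop), ← hcurry,
    ← Measure.map_map (by fun_prop) (by fun_prop), h'.map_fun_eq_infinitePi_map (by fun_prop),
    Measure.infinitePi_map_piCurry (X := X) (fun k i => μ.map (f i))]
  congr 1
  ext1 k
  exact ((h.precomp (g := fun i : {i // b i = k} => (i : ι))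
    Subtype.val_injective).map_fun_eq_infinitePi_map (by fun_prop)).symm

theorem measurable_flux {Ω : Type*} [MeasurableSpace Ω] {N P : List ℕ → Ω → ℕ}
    (hN : ∀ w, Measurable (N w)) (hP : ∀ w, Measurable (P w)) (h : ℕ) :
    ∀ w, Measurable fun ω => flux (fun u => N u ω) (fun u => P u ω) h w := by
  induction h with
  | zero => intro w; exact measurable_const
  | succ h ih =>
    intro w
    have h1 : Measurable fun x : ℕ × Ω => ∑ i ∈ Finset.range x.1,
        (flux (fun u => N u x.2) (fun u => P u x.2) h (i :: w) - 1) := by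
      apply measurable_from_prod_countable_right
      intro k
      have hpred : Measurable fun k : ℕ => k - 1 := .of_discrete
      change Measurable fun ω => ∑ i ∈ Finset.range k,
        (flux (fun u => N u ω) (fun u => P u ω) h (i :: w) - 1)
      exact Finset.measurable_sum _ fun i _ => hpred.comp (ih (i :: w))
    exact (hP w).add (h1.comp ((hN w).prodMk measurable_id))

/-- The numbers of children `N` and of cars `P` are independent, with laws Poisson(1) and
Poisson(`α`). -/
structure IsPoissonField {Ω T : Type*} [MeasurableSpace Ω] (μ : Measure Ω) (α : ℝ≥0)
    (N P : T → Ω → ℕ) : Prop where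
  measurable_left : ∀ v, Measurable (N v)
  measurable_right : ∀ v, Measurable (P v)
  map_left : ∀ v, μ.map (N v) = poissonMeasure 1
  map_right : ∀ v, μ.map (P v) = poissonMeasure α
  indep : iIndepFun (Sum.elim N P) μ

namespace IsPoissonField

variable {Ω T T' : Type*} [MeasurableSpace Ω] {μ : Measure Ω} {α : ℝ≥0}

theorem measurable_elim {N P : T → Ω → ℕ} (F : IsPoissonField μ α N P) (i : T ⊕ T) :
    Measurable (Sum.elim N P i) := by
  cases i with
  | inl v => exact F.measurable_left v
  | inr v => exact F.measurable_right v

theorem precomp {N P : T → Ω → ℕ} (F : IsPoissonField μ α N P) {e : T' → T}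
    (he : Function.Injective e) : IsPoissonField μ α (fun v => N (e v)) (fun v => P (e v)) where
  measurable_left v := F.measurable_left _
  measurable_right v := F.measurable_right _
  map_left v := F.map_left _
  map_right v := F.map_right _
  indep := by
    convert F.indep.precomp (g := Sum.map e e) (he.sumMap he) using 1
    ext i
    cases i <;> rfl

theorem map_elim_eq {N P N' P' : T → Ω → ℕ} (F : IsPoissonField μ α N P)
    (F' : IsPoissonField μ α N' P') :
    μ.map (fun ω i => Sum.elim N P i ω) = μ.map (fun ω i => Sum.elim N' P' i ω) := by
  rw [F.indep.map_fun_eq_infinitePi_map F.measurable_elim,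
    F'.indep.map_fun_eq_infinitePi_map F'.measurable_elim]
  congr 1
  ext1 i
  cases i with
  | inl v => exact (F.map_left v).trans (F'.map_left v).symm
  | inr v => exact (F.map_right v).trans (F'.map_right v).symm

/-- The law of the flux does not depend on the tree. -/
theorem map_flux_eq {N P N' P' : List ℕ → Ω → ℕ} (F : IsPoissonField μ α N P)
    (F' : IsPoissonField μ α N' P') (h : ℕ) :
    μ.map (fun ω => flux (fun w => N w ω) (fun w => P w ω) h []) =
      μ.map (fun ω => flux (fun w => N' w ω) (fun w => P' w ω) h []) := by
  have hm : Measurable fun x : List ℕ ⊕ List ℕ → ℕ =>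
      flux (fun w => x (Sum.inl w)) (fun w => x (Sum.inr w)) h [] :=
    measurable_flux (fun w => measurable_pi_apply _) (fun w => measurable_pi_apply _) h []
  have := congrArg (Measure.map fun x : List ℕ ⊕ List ℕ → ℕ =>
      flux (fun w => x (Sum.inl w)) (fun w => x (Sum.inr w)) h []) (F.map_elim_eq F')
  rwa [Measure.map_map hm (measurable_pi_iff.2 F.measurable_elim),
    Measure.map_map hm (measurable_pi_iff.2 F'.measurable_elim)] at this

/-- The law of the flux at a child of the progenitor is that at the progenitor. -/
theorem map_flux_singleton {N P : List ℕ → Ω → ℕ} (F : IsPoissonField μ α N P) (h i : ℕ) :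
    μ.map (fun ω => flux (fun w => N w ω) (fun w => P w ω) h [i]) =
      μ.map (fun ω => flux (fun w => N w ω) (fun w => P w ω) h []) := by
  rw [← (F.precomp (e := fun u => u ++ [i]) (List.append_left_injective [i])).map_flux_eq F h]
  congr 1
  ext1 ω
  exact flux_append _ _ [i] h []

/-- The number of children of the progenitor, the number of cars arriving there, and the numbers of
cars that would reach it from its potential children, as one sequence. -/
def rootData (N P : List ℕ → Ω → ℕ) (h : ℕ) : ℕ → Ω → ℕ
  | 0 => N []
  | 1 => P []
  | i + 2 => fun ω => flux (fun w => N w ω) (fun w => P w ω) h [i] - 1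

theorem measurable_rootData {N P : List ℕ → Ω → ℕ} (F : IsPoissonField μ α N P) (h : ℕ) :
    ∀ i, Measurable (rootData N P h i)
  | 0 => F.measurable_left _
  | 1 => F.measurable_right _
  | i + 2 => (Measurable.of_discrete (f := fun k : ℕ => k - 1)).comp
      (measurable_flux F.measurable_left F.measurable_right h [i])

theorem iIndepFun_rootData {N P : List ℕ → Ω → ℕ} (F : IsPoissonField μ α N P) (h : ℕ) :
    iIndepFun (rootData N P h) μ := by
  -- the last letter of a word says which child of the progenitor it descends from
  let b : List ℕ ⊕ List ℕ → ℕ := Sum.elim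
    (fun u => u.getLast?.elim 0 (· + 2)) (fun u => u.getLast?.elim 1 (· + 2))
  have hl : ∀ i u, b (Sum.inl (u ++ [i])) = i + 2 := by intro i u; simp [b]
  have hr : ∀ i u, b (Sum.inr (u ++ [i])) = i + 2 := by intro i u; simp [b]
  let g : (k : ℕ) → ({i // b i = k} → ℕ) → ℕ := fun k => match k with
    | 0 => fun x => x ⟨Sum.inl [], rfl⟩
    | 1 => fun x => x ⟨Sum.inr [], rfl⟩
    | i + 2 => fun x => flux (fun u => x ⟨Sum.inl (u ++ [i]), hl i u⟩)
        (fun u => x ⟨Sum.inr (u ++ [i]), hr i u⟩) h [] - 1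
  have hg : ∀ k, Measurable (g k) := fun k => match k with
    | 0 => measurable_pi_apply _
    | 1 => measurable_pi_apply _
    | i + 2 => (Measurable.of_discrete (f := fun k : ℕ => k - 1)).comp
        (measurable_flux (fun u => measurable_pi_apply _) (fun u => measurable_pi_apply _) h [])
  convert (iIndepFun_fiber F.measurable_elim F.indep b).comp g hg using 1
  ext k ω
  match k with
  | 0 => rfl
  | 1 => rfl
  | i + 2 => exact congrArg (· - 1) (flux_append _ _ [i] h [])

end IsPoissonField

/-- The fluxes at the vertices of the spine are independent. -/
theorem IsPoissonField.iIndepFun_spine {Ω : Type*} [MeasurableSpace Ω] {μ : Measure Ω} {α : ℝ≥0}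
    {N P : Vertex → Ω → ℕ} (F : IsPoissonField μ α N P) (h : ℕ) :
    iIndepFun (fun k ω => flux (fun w => N (k, w) ω) (fun w => P (k, w) ω) h []) μ := by
  let b : Vertex ⊕ Vertex → ℕ := Sum.elim Prod.fst Prod.fst
  exact (iIndepFun_fiber F.measurable_elim F.indep b).comp
    (fun k x => flux (fun w => x ⟨Sum.inl (k, w), rfl⟩) (fun w => x ⟨Sum.inr (k, w), rfl⟩) h [])
    (fun k => measurable_flux (fun u => measurable_pi_apply _)
      (fun u => measurable_pi_apply _) h [])

/-! ### Compound Poisson sums -/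

theorem lintegral_poissonMeasure (r : ℝ≥0) (f : ℕ → ℝ≥0∞) :
    ∫⁻ n, f n ∂poissonMeasure r =
      ∑' n : ℕ, ENNReal.ofReal (Real.exp (-r) * r ^ n / n.factorial) * f n := by
  rw [lintegral_countable']
  simp_rw [poissonMeasure_singleton, mul_comm]

/-- The Stein–Chen identity of the Poisson law. -/
theorem lintegral_mul_poissonMeasure (r : ℝ≥0) (f : ℕ → ℝ≥0∞) :
    ∫⁻ n, n * f n ∂poissonMeasure r = r * ∫⁻ n, f (n + 1) ∂poissonMeasure r := by
  rw [lintegral_poissonMeasure, lintegral_poissonMeasure, tsum_eq_zero_add' ENNReal.summable,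
    ← ENNReal.tsum_mul_left]
  simp only [Nat.cast_zero, zero_mul, mul_zero, zero_add]
  congr 1
  ext n
  have h : ENNReal.ofReal (Real.exp (-r) * r ^ (n + 1) / (n + 1).factorial) * ((n + 1 : ℕ) : ℝ≥0∞) =
      r * ENNReal.ofReal (Real.exp (-r) * r ^ n / n.factorial) := by
    rw [← ENNReal.ofReal_natCast, ← ENNReal.ofReal_coe_nnreal, ← ENNReal.ofReal_mul (by positivity),
      ← ENNReal.ofReal_mul (by positivity), Nat.factorial_succ]
    congr 1
    push_cast
    field_simp
    ring
  rw [← mul_assoc, h, mul_assoc]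

theorem lintegral_pow_poissonMeasure (r : ℝ≥0) {s : ℝ} (hs : 0 ≤ s) :
    ∫⁻ n, ENNReal.ofReal s ^ n ∂poissonMeasure r = ENNReal.ofReal (Real.exp (r * (s - 1))) := by
  have h : HasSum (fun n : ℕ => Real.exp (-r) * r ^ n / n.factorial * s ^ n)
      (Real.exp (r * (s - 1))) := by
    have := (NormedSpace.expSeries_div_hasSum_exp ((r : ℝ) * s)).mul_left (Real.exp (-r))
    rw [← Real.exp_eq_exp_ℝ, ← Real.exp_add] at this
    have e : (r : ℝ) * (s - 1) = -r + r * s := by ring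
    have e' : (fun n : ℕ => Real.exp (-r) * r ^ n / n.factorial * s ^ n) =
        fun n : ℕ => Real.exp (-r) * ((r * s) ^ n / n.factorial) := by
      ext n
      rw [mul_pow]
      ring
    rw [e, e']
    exact this
  rw [lintegral_poissonMeasure, ← h.tsum_eq,
    ENNReal.ofReal_tsum_of_nonneg (fun n => by positivity) h.summable]
  congr 1
  ext n
  rw [← ENNReal.ofReal_pow hs, ← ENNReal.ofReal_mul (by positivity)]

/-- The random sum `V 1 + (V 2 + ⋯ + V (n + 1))` with a fixed number `n` of terms in the bracket. -/
def partialSum {Ω : Type*} (V : ℕ → Ω → ℕ) (n : ℕ) (ω : Ω) : ℕ :=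
  V 1 ω + ∑ i ∈ Finset.range n, V (i + 2) ω

theorem partialSum_eq {Ω : Type*} (V : ℕ → Ω → ℕ) (n : ℕ) :
    partialSum V n = ∑ j ∈ Finset.Ico 1 (n + 2), V j := by
  ext ω
  rw [Finset.sum_apply, Finset.sum_eq_sum_Ico_succ_bot (by omega), Finset.sum_Ico_eq_sum_range,
    partialSum]
  simp only [Nat.add_sub_cancel, Nat.reduceAdd, add_comm]

theorem partialSum_succ {Ω : Type*} (V : ℕ → Ω → ℕ) (n : ℕ) (ω : Ω) :
    partialSum V (n + 1) ω = partialSum V n ω + V (n + 2) ω := by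
  rw [partialSum, partialSum, Finset.sum_range_succ, add_assoc]

/-- The product `k (k - 1)`, whose expectation is the second factorial moment. -/
def fallingTwo (k : ℕ) : ℕ := k * (k - 1)

theorem fallingTwo_add (a b : ℕ) :
    fallingTwo (a + b) = fallingTwo a + fallingTwo b + 2 * (a * b) := by
  rcases a with _ | a <;> rcases b with _ | b <;> simp [fallingTwo]
  ring

theorem lintegral_fallingTwo_poissonMeasure (r : ℝ≥0) :
    ∫⁻ n, (fallingTwo n : ℝ≥0∞) ∂poissonMeasure r = r ^ 2 := by
  have h1 := lintegral_mul_poissonMeasure r (fun n => ((n - 1 : ℕ) : ℝ≥0∞))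
  have h2 := lintegral_mul_poissonMeasure r (fun _ => 1)
  simp only [mul_one, lintegral_one, measure_univ] at h2
  simp only [fallingTwo, Nat.cast_mul]
  rw [h1]
  simp only [Nat.add_sub_cancel]
  rw [h2, sq]

theorem lintegral_natCast_poissonMeasure (r : ℝ≥0) :
    ∫⁻ n, (n : ℝ≥0∞) ∂poissonMeasure r = r := by
  have h2 := lintegral_mul_poissonMeasure r (fun _ => 1)
  simpa using h2

/-- The ingredients of the sum `V 1 + (V 2 + ⋯ + V (V 0 + 1))`: independent variables, a Poisson(1)
number `V 0` of terms in the bracket, which have a common law, and a Poisson(`α`) variable `V 1`. -/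
structure IsCompound {Ω : Type*} [MeasurableSpace Ω] (μ : Measure Ω) (α : ℝ≥0)
    (V : ℕ → Ω → ℕ) : Prop where
  measurable : ∀ i, Measurable (V i)
  indep : iIndepFun V μ
  map_zero : μ.map (V 0) = poissonMeasure 1
  map_one : μ.map (V 1) = poissonMeasure α
  map_add_two : ∀ i, μ.map (V (i + 2)) = μ.map (V 2)

namespace IsCompound

variable {Ω : Type*} [MeasurableSpace Ω] {μ : Measure Ω} {α : ℝ≥0} {V : ℕ → Ω → ℕ}

theorem measurable_partialSum (H : IsCompound μ α V) (n : ℕ) : Measurable (partialSum V n) :=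
  (H.measurable 1).add (Finset.measurable_sum _ fun i _ => H.measurable (i + 2))

theorem measurable_comp_partialSum (H : IsCompound μ α V) (f : ℕ → ℝ≥0∞) (n : ℕ) :
    Measurable fun ω => f (partialSum V n ω) :=
  (Measurable.of_discrete (f := f)).comp (H.measurable_partialSum n)

theorem measurable_comp (H : IsCompound μ α V) (f : ℕ → ℝ≥0∞) (i : ℕ) :
    Measurable fun ω => f (V i ω) :=
  (Measurable.of_discrete (f := f)).comp (H.measurable i)

theorem lintegral_zero (H : IsCompound μ α V) (f : ℕ → ℝ≥0∞) :
    ∫⁻ ω, f (V 0 ω) ∂μ = ∫⁻ n, f n ∂poissonMeasure 1 := by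
  rw [← H.map_zero, lintegral_map .of_discrete (H.measurable 0)]

theorem lintegral_one (H : IsCompound μ α V) (f : ℕ → ℝ≥0∞) :
    ∫⁻ ω, f (V 1 ω) ∂μ = ∫⁻ n, f n ∂poissonMeasure α := by
  rw [← H.map_one, lintegral_map .of_discrete (H.measurable 1)]

theorem lintegral_add_two (H : IsCompound μ α V) (f : ℕ → ℝ≥0∞) (i : ℕ) :
    ∫⁻ ω, f (V (i + 2) ω) ∂μ = ∫⁻ ω, f (V 2 ω) ∂μ := by
  rw [← lintegral_map (f := f) .of_discrete (H.measurable _), H.map_add_two,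
    lintegral_map .of_discrete (H.measurable 2)]

theorem indepFun_partialSum (H : IsCompound μ α V) (n : ℕ) {j : ℕ} (hj : j ∉ Finset.Ico 1 (n + 2)) :
    IndepFun (partialSum V n) (V j) μ := by
  rw [partialSum_eq]
  exact H.indep.indepFun_finsetSum_of_notMem H.measurable hj

/-- The next term is independent of the sum up to it. -/
theorem lintegral_mul (H : IsCompound μ α V) (f g : ℕ → ℝ≥0∞) (n : ℕ) :
    ∫⁻ ω, f (partialSum V n ω) * g (V (n + 2) ω) ∂μ =
      (∫⁻ ω, f (partialSum V n ω) ∂μ) * ∫⁻ ω, g (V 2 ω) ∂μ := by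
  rw [← H.lintegral_add_two g n]
  exact lintegral_mul_eq_lintegral_mul_lintegral_of_indepFun (H.measurable_comp_partialSum f n)
    (H.measurable_comp g (n + 2))
    ((H.indepFun_partialSum n (j := n + 2) (by simp)).comp .of_discrete .of_discrete)

/-- Conditioning on the number of terms. -/
theorem lintegral_partialSum (H : IsCompound μ α V) (f : ℕ → ℝ≥0∞) :
    ∫⁻ ω, f (partialSum V (V 0 ω) ω) ∂μ =
      ∫⁻ n, ∫⁻ ω, f (partialSum V n ω) ∂μ ∂poissonMeasure 1 := by
  have h1 : ∀ ω, f (partialSum V (V 0 ω) ω) =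
      ∑' n, f (partialSum V n ω) * ({n} : Set ℕ).indicator 1 (V 0 ω) := by
    intro ω
    rw [tsum_eq_single (V 0 ω)]
    · simp
    · intro n hn
      simp [Set.indicator_of_notMem, hn.symm]
  have hm := H.measurable_comp_partialSum f
  have hm0 := fun n => H.measurable_comp (({n} : Set ℕ).indicator (1 : ℕ → ℝ≥0∞)) 0
  have hmul : ∀ n, AEMeasurable (fun ω => f (partialSum V n ω) *
      ({n} : Set ℕ).indicator 1 (V 0 ω)) μ := fun n => ((hm n).mul (hm0 n)).aemeasurable
  simp_rw [h1]
  rw [lintegral_tsum hmul, lintegral_countable']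
  congr 1
  ext n
  have hind := (H.indepFun_partialSum n (j := 0) (by simp)).comp
    (φ := f) (ψ := ({n} : Set ℕ).indicator (1 : ℕ → ℝ≥0∞)) .of_discrete .of_discrete
  have := lintegral_mul_eq_lintegral_mul_lintegral_of_indepFun (hm n) (hm0 n) hind
  simp only [Pi.mul_apply] at this
  rw [this, H.lintegral_zero, lintegral_indicator_one (MeasurableSet.singleton n)]

theorem lintegral_pow_partialSum (H : IsCompound μ α V) (s : ℝ≥0∞) (n : ℕ) :
    ∫⁻ ω, s ^ partialSum V n ω ∂μ =
      (∫⁻ k, s ^ k ∂poissonMeasure α) * (∫⁻ ω, s ^ V 2 ω ∂μ) ^ n := by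
  induction n with
  | zero =>
    simp only [partialSum, Finset.range_zero, Finset.sum_empty, add_zero, pow_zero, mul_one]
    exact H.lintegral_one (fun k => s ^ k)
  | succ n ih =>
    simp only [partialSum_succ, pow_add]
    rw [H.lintegral_mul (fun k => s ^ k) (fun k => s ^ k), ih, pow_one, mul_assoc]

theorem lintegral_natCast_partialSum (H : IsCompound μ α V) (n : ℕ) :
    ∫⁻ ω, (partialSum V n ω : ℝ≥0∞) ∂μ = α + n * ∫⁻ ω, (V 2 ω : ℝ≥0∞) ∂μ := by
  induction n with
  | zero =>
    simp only [partialSum, Finset.range_zero, Finset.sum_empty, add_zero, Nat.cast_zero, zero_mul]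
    rw [H.lintegral_one (fun k => (k : ℝ≥0∞)), lintegral_natCast_poissonMeasure]
  | succ n ih =>
    simp only [partialSum_succ, Nat.cast_add, Nat.cast_one]
    rw [lintegral_add_left (H.measurable_comp_partialSum (fun k => k) n), ih,
      H.lintegral_add_two (fun k => (k : ℝ≥0∞)) n]
    ring

theorem lintegral_fallingTwo_partialSum (H : IsCompound μ α V) (n : ℕ) :
    ∫⁻ ω, (fallingTwo (partialSum V n ω) : ℝ≥0∞) ∂μ =
      α ^ 2 + n * (∫⁻ ω, (fallingTwo (V 2 ω) : ℝ≥0∞) ∂μ + 2 * α * ∫⁻ ω, (V 2 ω : ℝ≥0∞) ∂μ) +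
        fallingTwo n * (∫⁻ ω, (V 2 ω : ℝ≥0∞) ∂μ) ^ 2 := by
  induction n with
  | zero =>
    simp only [partialSum, Finset.range_zero, Finset.sum_empty, add_zero, Nat.cast_zero, zero_mul,
      fallingTwo]
    exact (H.lintegral_one (fun k => (fallingTwo k : ℝ≥0∞))).trans
      (lintegral_fallingTwo_poissonMeasure α)
  | succ n ih =>
    have hd := H.measurable_comp_partialSum (fun k => fallingTwo k) n
    have hd' := H.measurable_comp (fun k => fallingTwo k) (n + 2)
    have hdd : Measurable fun ω => (fallingTwo (partialSum V n ω) : ℝ≥0∞) +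
      fallingTwo (V (n + 2) ω) := hd.add hd'
    have hprod : Measurable fun ω => (partialSum V n ω : ℝ≥0∞) * V (n + 2) ω :=
      (H.measurable_comp_partialSum (fun k => k) n).mul (H.measurable_comp (fun k => k) (n + 2))
    simp only [partialSum_succ, fallingTwo_add, Nat.cast_add, Nat.cast_mul]
    rw [lintegral_add_left hdd, lintegral_add_left hd, lintegral_const_mul _ hprod,
      H.lintegral_mul (fun k => (k : ℝ≥0∞)) (fun k => (k : ℝ≥0∞)), ih,
      H.lintegral_natCast_partialSum,
      H.lintegral_add_two (fun k => (fallingTwo k : ℝ≥0∞)) n]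
    simp only [fallingTwo, Nat.cast_one, Nat.cast_ofNat, Nat.sub_self, mul_zero, Nat.cast_zero]
    ring

/-- The generating function of the compound sum; `c` is that of a term of the bracket. -/
theorem lintegral_pow_compound (H : IsCompound μ α V) {s c : ℝ} (hs : 0 ≤ s) (hc : 0 ≤ c)
    (h : ∫⁻ ω, ENNReal.ofReal s ^ V 2 ω ∂μ = ENNReal.ofReal c) :
    ∫⁻ ω, ENNReal.ofReal s ^ partialSum V (V 0 ω) ω ∂μ =
      ENNReal.ofReal (Real.exp (α * (s - 1) + (c - 1))) := by
  rw [H.lintegral_partialSum (fun k => ENNReal.ofReal s ^ k)]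
  simp_rw [H.lintegral_pow_partialSum, h]
  rw [lintegral_const_mul _ .of_discrete, lintegral_pow_poissonMeasure _ hs,
    lintegral_pow_poissonMeasure _ hc, ← ENNReal.ofReal_mul (by positivity), ← Real.exp_add]
  simp

theorem lintegral_natCast_compound (H : IsCompound μ α V) :
    ∫⁻ ω, (partialSum V (V 0 ω) ω : ℝ≥0∞) ∂μ = α + ∫⁻ ω, (V 2 ω : ℝ≥0∞) ∂μ := by
  rw [H.lintegral_partialSum (fun k => (k : ℝ≥0∞))]
  simp_rw [H.lintegral_natCast_partialSum]
  rw [lintegral_add_left .of_discrete, lintegral_mul_const _ .of_discrete,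
    lintegral_natCast_poissonMeasure]
  simp

/-- As for the Poisson law itself, `E Z (Z - 1)` exceeds `(E Z) ^ 2` only by the second factorial
moment of a term of the bracket, since the expected number of such terms is `1`. -/
theorem lintegral_fallingTwo_compound (H : IsCompound μ α V) :
    ∫⁻ ω, (fallingTwo (partialSum V (V 0 ω) ω) : ℝ≥0∞) ∂μ =
      (∫⁻ ω, (partialSum V (V 0 ω) ω : ℝ≥0∞) ∂μ) ^ 2 +
        ∫⁻ ω, (fallingTwo (V 2 ω) : ℝ≥0∞) ∂μ := by
  rw [H.lintegral_partialSum (fun k => (fallingTwo k : ℝ≥0∞)), H.lintegral_natCast_compound]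
  simp_rw [H.lintegral_fallingTwo_partialSum]
  rw [lintegral_add_left .of_discrete, lintegral_add_left .of_discrete,
    lintegral_mul_const _ .of_discrete, lintegral_mul_const _ .of_discrete,
    lintegral_natCast_poissonMeasure, lintegral_fallingTwo_poissonMeasure]
  simp
  ring

end IsCompound

/-! ### Random walks with steps at least `-1` -/

/-- Summing the renewal recursion `a j = ∑ a l * p (j + 1 - l)` over `j`, where `u` is the tail
of `p`. -/
theorem mul_eq_sub_sum_tail {a p u : ℕ → ℝ} (hu0 : u 0 = 1 - p 0)
    (hu : ∀ k, u k = p (k + 1) + u (k + 1))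
    (ha : ∀ j, a j = ∑ l ∈ Finset.range (j + 2), a l * p (j + 1 - l)) (J : ℕ) :
    p 0 * a 0 = a J - ∑ l ∈ Finset.range (J + 1), a l * u (J - l) := by
  induction J with
  | zero => simp [hu0]; ring
  | succ J ih =>
    have h1 := ha J
    rw [Finset.sum_range_succ, Nat.sub_self] at h1
    rw [Finset.sum_range_succ, Nat.sub_self, hu0]
    have h2 : ∑ l ∈ Finset.range (J + 1), a l * u (J - l) =
        ∑ l ∈ Finset.range (J + 1), a l * p (J + 1 - l) +
          ∑ l ∈ Finset.range (J + 1), a l * u (J + 1 - l) := by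
      rw [← Finset.sum_add_distrib]
      refine Finset.sum_congr rfl fun l hl => ?_
      have hl' : J + 1 - l = J - l + 1 := by
        have := Finset.mem_range.1 hl
        omega
      rw [hu, hl']
      ring
    rw [ih]
    linarith

/-- If `a` converges, then its convolution with a summable sequence converges as well. -/
theorem tendsto_sum_range_mul {a u : ℕ → ℝ} {L m : ℝ} (ha0 : ∀ j, |a j| ≤ 1)
    (hu0 : ∀ k, 0 ≤ u k) (hu : HasSum u m)
    (ha : Filter.Tendsto a Filter.atTop (nhds L)) :
    Filter.Tendsto (fun J => ∑ l ∈ Finset.range (J + 1), a l * u (J - l)) Filter.atTop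
      (nhds (L * m)) := by
  have h1 : ∀ J, ∑ l ∈ Finset.range (J + 1), a l * u (J - l) =
      ∑' k, if k < J + 1 then a (J - k) * u k else 0 := by
    intro J
    rw [tsum_eq_sum (s := Finset.range (J + 1))
      (fun k hk => if_neg (fun h => hk (Finset.mem_range.2 h))),
      ← Finset.sum_range_reflect]
    refine Finset.sum_congr rfl fun k hk => ?_
    have hk' := Finset.mem_range.1 hk
    rw [if_pos hk']
    have e : J - (J + 1 - 1 - k) = k := by omega
    rw [e, Nat.add_sub_cancel]
  simp_rw [h1]
  rw [← hu.tsum_eq, ← tsum_mul_left]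
  refine tendsto_tsum_of_dominated_convergence hu.summable ?_ ?_
  · intro k
    refine Filter.Tendsto.congr' ?_ ((ha.comp (Filter.tendsto_sub_atTop_nat k)).mul_const (u k))
    filter_upwards [Filter.eventually_ge_atTop k] with J hJ
    rw [if_pos (by omega), Function.comp_apply]
  · filter_upwards with J k
    split_ifs
    · rw [Real.norm_eq_abs, abs_mul, abs_of_nonneg (hu0 k)]
      exact mul_le_of_le_one_left (hu0 k) (ha0 _)
    · simpa using hu0 k

/-- The paths `x` for which the walk with steps `x i - 1` never exceeds `j`. -/
def stayBelow (j : ℕ) : Set (ℕ → ℕ) := {x | ∀ n, ∑ i ∈ Finset.range n, x i ≤ n + j}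

theorem measurableSet_stayBelow (j : ℕ) : MeasurableSet (stayBelow j) := by
  have : stayBelow j = ⋂ n, {x | ∑ i ∈ Finset.range n, x i ≤ n + j} := by
    ext x; simp [stayBelow]
  rw [this]
  refine MeasurableSet.iInter fun n => measurableSet_le ?_ measurable_const
  exact Finset.measurable_sum _ fun i _ => measurable_pi_apply i

theorem stayBelow_mono : Monotone stayBelow := fun _ _ h _ hx n => (hx n).trans (by omega)

/-- Splitting according to the first step. -/
theorem mem_stayBelow_iff (j : ℕ) (x : ℕ → ℕ) :
    x ∈ stayBelow j ↔ x 0 ≤ j + 1 ∧ (fun i => x (i + 1)) ∈ stayBelow (j + 1 - x 0) := by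
  constructor
  · intro h
    have h0 : x 0 ≤ j + 1 := by
      have := h 1
      rw [Finset.sum_range_one] at this
      omega
    refine ⟨h0, fun n => ?_⟩
    have := h (n + 1)
    rw [Finset.sum_range_succ'] at this
    dsimp only
    omega
  · rintro ⟨h0, h⟩ n
    cases n with
    | zero => simp
    | succ n =>
      rw [Finset.sum_range_succ']
      have := h n
      dsimp only at this
      omega

section Walk

variable {Ω : Type*} [MeasurableSpace Ω] {μ : Measure Ω} {X : ℕ → Ω → ℕ}

theorem map_shift_eq (hX : ∀ i, Measurable (X i)) (hind : iIndepFun X μ)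
    (hlaw : ∀ i, μ.map (X i) = μ.map (X 0)) :
    μ.map (fun ω i => X (i + 1) ω) = μ.map (fun ω i => X i ω) := by
  rw [(hind.precomp (g := fun i : ℕ => i + 1)
      (add_left_injective 1)).map_fun_eq_infinitePi_map (fun i => hX _),
    hind.map_fun_eq_infinitePi_map hX]
  congr 1
  ext1 i
  rw [hlaw (i + 1), hlaw i]

theorem indepFun_head_tail (hX : ∀ i, Measurable (X i)) (hind : iIndepFun X μ) :
    IndepFun (X 0) (fun ω i => X (i + 1) ω) μ := by
  have h := (iIndepFun_fiber hX hind (fun i => decide (i = 0))).indepFun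
    (i := true) (j := false) (by simp)
  have hφ : Measurable fun x : {i : ℕ // decide (i = 0) = true} → ℕ => x ⟨0, rfl⟩ :=
    measurable_pi_apply _
  have hψ : Measurable fun (x : {i : ℕ // decide (i = 0) = false} → ℕ) (i : ℕ) => x ⟨i + 1, rfl⟩ :=
    measurable_pi_iff.2 fun i => measurable_pi_apply _
  exact h.comp hφ hψ

theorem measureReal_stayBelow_eq_sum (hX : ∀ i, Measurable (X i)) (hind : iIndepFun X μ)
    (hlaw : ∀ i, μ.map (X i) = μ.map (X 0)) (j : ℕ) :
    μ.real {ω | (fun i => X i ω) ∈ stayBelow j} = ∑ l ∈ Finset.range (j + 2),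
      μ.real {ω | (fun i => X i ω) ∈ stayBelow l} * μ.real {ω | X 0 ω = j + 1 - l} := by
  have := hind.isProbabilityMeasure
  have hsplit : {ω | (fun i => X i ω) ∈ stayBelow j} = ⋃ l ∈ Finset.range (j + 2),
      ({ω | X 0 ω = j + 1 - l} ∩ {ω | (fun i => X (i + 1) ω) ∈ stayBelow l}) := by
    ext ω
    simp only [Set.mem_ofPred_eq, Set.mem_iUnion, Set.mem_inter_iff, Finset.mem_range]
    rw [mem_stayBelow_iff]
    constructor
    · rintro ⟨h0, h⟩
      exact ⟨j + 1 - X 0 ω, by omega, by omega, h⟩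
    · rintro ⟨l, hl, h0, h⟩
      have : j + 1 - X 0 ω = l := by omega
      rw [this]
      exact ⟨by omega, h⟩
  have hm0 : ∀ l, MeasurableSet {ω | X 0 ω = j + 1 - l} := fun l =>
    hX 0 (measurableSet_singleton _)
  have hm1 : ∀ l, MeasurableSet {ω | (fun i => X (i + 1) ω) ∈ stayBelow l} := fun l =>
    (measurable_pi_iff.2 fun i => hX (i + 1)) (measurableSet_stayBelow l)
  rw [hsplit, measureReal_biUnion_finset]
  · refine Finset.sum_congr rfl fun l _ => ?_
    have hi := (indepFun_head_tail hX hind).measure_inter_preimage_eq_mul {j + 1 - l}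
      (stayBelow l) (measurableSet_singleton _) (measurableSet_stayBelow l)
    have hs : μ {ω | (fun i => X (i + 1) ω) ∈ stayBelow l} =
        μ {ω | (fun i => X i ω) ∈ stayBelow l} := by
      have := congrArg (fun ν => ν (stayBelow l)) (map_shift_eq hX hind hlaw)
      rwa [Measure.map_apply (measurable_pi_iff.2 fun i => hX (i + 1)) (measurableSet_stayBelow l),
        Measure.map_apply (measurable_pi_iff.2 hX) (measurableSet_stayBelow l)] at this
    rw [measureReal_def, measureReal_def, measureReal_def, ← hs, mul_comm, ← ENNReal.toReal_mul]
    exact congrArg ENNReal.toReal hi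
  · intro l hl l' hl' hne
    have h1 := Finset.mem_range.1 hl
    have h2 := Finset.mem_range.1 hl'
    refine Set.disjoint_left.2 fun ω h h' => hne ?_
    have h3 : X 0 ω = j + 1 - l := h.1
    have h4 : X 0 ω = j + 1 - l' := h'.1
    omega
  · exact fun l _ => (hm0 l).inter (hm1 l)

/-- The mean of a natural-number-valued variable is the sum of its tail probabilities. -/
theorem hasSum_measureReal_lt [IsProbabilityMeasure μ] {Y : Ω → ℕ} (hY : Measurable Y)
    (hfin : ∫⁻ ω, (Y ω : ℝ≥0∞) ∂μ ≠ ∞) :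
    HasSum (fun k => μ.real {ω | k < Y ω}) (∫⁻ ω, (Y ω : ℝ≥0∞) ∂μ).toReal := by
  have hm : ∀ k : ℕ, MeasurableSet {ω | k < Y ω} := fun k => measurableSet_lt measurable_const hY
  have h1 : ∀ ω, (Y ω : ℝ≥0∞) = ∑' k, ({ω | k < Y ω} : Set Ω).indicator 1 ω := by
    intro ω
    rw [tsum_eq_sum (s := Finset.range (Y ω))]
    · rw [Finset.sum_congr rfl (g := fun _ => (1 : ℝ≥0∞))]
      · simp
      · intro k hk
        exact Set.indicator_of_mem (s := {ω | k < Y ω}) (Finset.mem_range.1 hk) _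
    · intro k hk
      exact Set.indicator_of_notMem (s := {ω | k < Y ω}) (fun h => hk (Finset.mem_range.2 h)) _
  have h2 : ∫⁻ ω, (Y ω : ℝ≥0∞) ∂μ = ∑' k, μ {ω | k < Y ω} := by
    simp_rw [h1]
    rw [lintegral_tsum fun k => (measurable_one.indicator (hm k)).aemeasurable]
    congr 1
    ext k
    exact lintegral_indicator_one (hm k)
  rw [h2] at hfin ⊢
  rw [ENNReal.tsum_toReal_eq (fun k => measure_ne_top _ _)]
  exact (ENNReal.summable_toReal hfin).hasSum

/-- By the law of large numbers a walk with negative drift is bounded above. -/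
theorem ae_exists_mem_stayBelow (hX : ∀ i, Measurable (X i)) (hind : iIndepFun X μ)
    (hlaw : ∀ i, μ.map (X i) = μ.map (X 0)) (hfin : ∫⁻ ω, (X 0 ω : ℝ≥0∞) ∂μ < 1) :
    ∀ᵐ ω ∂μ, ∃ j, (fun i => X i ω) ∈ stayBelow j := by
  have hc : Measurable fun k : ℕ => (k : ℝ) := .of_discrete
  have henorm : ∀ ω, ENNReal.ofReal (X 0 ω : ℝ) = (X 0 ω : ℝ≥0∞) := fun ω =>
    ENNReal.ofReal_natCast _
  have hint : Integrable (fun ω => (X 0 ω : ℝ)) μ := by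
    refine ⟨(hc.comp (hX 0)).aestronglyMeasurable, ?_⟩
    rw [hasFiniteIntegral_iff_ofReal (Filter.Eventually.of_forall fun ω => Nat.cast_nonneg _)]
    simp_rw [henorm]
    exact hfin.trans ENNReal.one_lt_top
  have hmean : ∫ ω, (X 0 ω : ℝ) ∂μ < 1 := by
    rw [integral_eq_lintegral_of_nonneg_ae (Filter.Eventually.of_forall fun ω => Nat.cast_nonneg _)
      hint.aestronglyMeasurable]
    simp_rw [henorm]
    exact (ENNReal.toReal_lt_toReal hfin.ne_top ENNReal.one_ne_top).2 hfin
  have hlln := strong_law_ae_real (fun i ω => (X i ω : ℝ)) hint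
    (fun i j hij => (hind.indepFun hij).comp hc hc)
    (fun i => (IdentDistrib.mk (hX i).aemeasurable (hX 0).aemeasurable (hlaw i)).comp hc)
  filter_upwards [hlln] with ω hω
  obtain ⟨n₀, hn₀⟩ := Filter.eventually_atTop.1 (hω.eventually_lt_const hmean)
  refine ⟨∑ i ∈ Finset.range (n₀ + 1), X i ω, fun n => ?_⟩
  rcases le_or_gt n (n₀ + 1) with h | h
  · have : ∑ i ∈ Finset.range n, X i ω ≤ ∑ i ∈ Finset.range (n₀ + 1), X i ω :=
      Finset.sum_le_sum_of_subset (Finset.range_mono h)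
    dsimp only
    omega
  · have h1 := hn₀ n (by omega)
    rw [div_lt_one (by exact_mod_cast (by omega : 0 < n))] at h1
    have h2 : ∑ i ∈ Finset.range n, X i ω < n := by exact_mod_cast h1
    dsimp only
    omega

/-- The probability that a random walk with steps `X i - 1` never becomes positive. -/
theorem measureReal_stayBelow_zero (hX : ∀ i, Measurable (X i)) (hind : iIndepFun X μ)
    (hlaw : ∀ i, μ.map (X i) = μ.map (X 0)) (hfin : ∫⁻ ω, (X 0 ω : ℝ≥0∞) ∂μ ≠ ∞) :
    μ.real {ω | X 0 ω = 0} * μ.real {ω | (fun i => X i ω) ∈ stayBelow 0} =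
      max 0 (1 - (∫⁻ ω, (X 0 ω : ℝ≥0∞) ∂μ).toReal) := by
  have := hind.isProbabilityMeasure
  set m := (∫⁻ ω, (X 0 ω : ℝ≥0∞) ∂μ).toReal with hm
  set L := μ.real (⋃ j, {ω | (fun i => X i ω) ∈ stayBelow j}) with hL
  have hL0 : 0 ≤ L := measureReal_nonneg
  have hlim : Filter.Tendsto (fun j => μ.real {ω | (fun i => X i ω) ∈ stayBelow j}) Filter.atTop
      (nhds L) :=
    (ENNReal.tendsto_toReal (measure_ne_top _ _)).comp
      (tendsto_measure_iUnion_atTop fun i j hij ω h => stayBelow_mono hij h)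
  have hid := mul_eq_sub_sum_tail (a := fun j => μ.real {ω | (fun i => X i ω) ∈ stayBelow j})
    (p := fun k => μ.real {ω | X 0 ω = k}) (u := fun k => μ.real {ω | k < X 0 ω})
    (by
      have h0 : MeasurableSet {ω | X 0 ω = 0} := hX 0 (measurableSet_singleton 0)
      rw [← probReal_compl_eq_one_sub h0]
      congr 1
      ext ω
      exact Nat.pos_iff_ne_zero)
    (by
      intro k
      rw [← measureReal_union]
      · congr 1
        ext ω
        simp only [Set.mem_ofPred_eq, Set.mem_union]
        omega
      · exact Set.disjoint_left.2 fun ω (h : X 0 ω = k + 1) (h' : k + 1 < X 0 ω) => by omega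
      · exact measurableSet_lt measurable_const (hX 0))
    (measureReal_stayBelow_eq_sum hX hind hlaw)
  have htan := tendsto_sum_range_mul
    (a := fun j => μ.real {ω | (fun i => X i ω) ∈ stayBelow j})
    (fun j => by rw [abs_of_nonneg measureReal_nonneg]; exact measureReal_le_one)
    (fun k => measureReal_nonneg) (hasSum_measureReal_lt (hX 0) hfin) hlim
  have heq : μ.real {ω | X 0 ω = 0} * μ.real {ω | (fun i => X i ω) ∈ stayBelow 0} = L - L * m :=
    tendsto_nhds_unique (tendsto_const_nhds.congr hid) (hlim.sub htan)
  rcases lt_or_ge m 1 with h | h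
  · have h1 : L = 1 := by
      have hlt : ∫⁻ ω, (X 0 ω : ℝ≥0∞) ∂μ < 1 := by
        rw [← ENNReal.toReal_lt_toReal hfin ENNReal.one_ne_top]
        simpa using h
      have hae := ae_exists_mem_stayBelow hX hind hlaw hlt
      have : μ (⋃ j, {ω | (fun i => X i ω) ∈ stayBelow j}) = 1 := by
        rw [← measure_univ (μ := μ)]
        refine measure_congr ?_
        filter_upwards [hae] with ω hω
        exact eq_true (Set.mem_iUnion.2 hω)
      rw [hL, measureReal_def, this, ENNReal.toReal_one]
    rw [heq, h1, max_eq_right (by linarith)]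
    ring
  · rw [max_eq_left (by linarith)]
    refine le_antisymm ?_ (mul_nonneg measureReal_nonneg measureReal_nonneg)
    rw [heq]
    nlinarith

end Walk

/-! ### The critical equation for the mean flux -/

/-- The relations between the characteristics of the truncated fluxes `X h`: the means `m h`, the
second factorial moments `q h`, the probabilities `p h` of the value `0`, the generating functions
`G h`, and the mean `y h`, second factorial moment `z h` and generating function `g h` of the
positive part of `X h - 1`. -/
structure FluxMoments (α : ℝ) (m q p y z : ℕ → ℝ) (G g : ℕ → ℝ → ℝ) : Prop where
  m_zero : m 0 = 0
  m_succ : ∀ h, m (h + 1) = α + y h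
  m_add_p : ∀ h, m h + p h = y h + 1
  q_eq : ∀ h, q h = z h + 2 * y h
  q_succ : ∀ h, q (h + 1) = m (h + 1) ^ 2 + z h
  m_mono : Monotone m
  q_mono : Monotone q
  z_mono : Monotone z
  y_zero : y 0 = 0
  G_eq : ∀ h, ∀ s ∈ Set.Ioo (0 : ℝ) 1, G h s + s * p h = s * g h s + p h
  G_succ : ∀ h, ∀ s ∈ Set.Ioo (0 : ℝ) 1, G (h + 1) s = Real.exp (α * (s - 1) + (g h s - 1))
  G_nonneg : ∀ h, ∀ s ∈ Set.Ioo (0 : ℝ) 1, 0 ≤ G h s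
  G_anti : ∀ s ∈ Set.Ioo (0 : ℝ) 1, Antitone fun h => G h s
  one_sub_G_le : ∀ h, ∀ s ∈ Set.Ioo (0 : ℝ) 1, 1 - G h s ≤ m h * (1 - s)
  le_one_sub_G : ∀ h, ∀ s ∈ Set.Ioo (0 : ℝ) 1,
    m h * (1 - s) - q h * (1 - s) ^ 2 / 2 ≤ 1 - G h s

/-- The second-order expansion at `ε = 0` of the equation satisfied by the limit of the generating
functions, with `γ ε = 1 - G (1 - ε)`. -/
theorem quadratic_of_tendsto {α M : ℝ} {γ : ℝ → ℝ}
    (heq : ∀ ε ∈ Set.Ioo (0 : ℝ) 1,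
      Real.log (1 - γ ε) + γ ε = (α * ε ^ 2 - γ ε * ε) / (1 - ε))
    (hlim : Filter.Tendsto (fun ε => γ ε / ε) (nhdsWithin 0 (Set.Ioi 0)) (nhds M)) :
    M ^ 2 - 2 * M + 2 * α = 0 := by
  have hid : Filter.Tendsto (fun ε : ℝ => ε) (nhdsWithin 0 (Set.Ioi 0)) (nhds 0) :=
    Filter.tendsto_id.mono_left nhdsWithin_le_nhds
  have hIoo : ∀ᶠ ε : ℝ in nhdsWithin 0 (Set.Ioi 0), ε ∈ Set.Ioo (0 : ℝ) 1 :=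
    Ioo_mem_nhdsGT one_pos
  have hγ : Filter.Tendsto γ (nhdsWithin 0 (Set.Ioi 0)) (nhds 0) := by
    have := hlim.mul hid
    rw [mul_zero] at this
    refine this.congr' ?_
    filter_upwards [hIoo] with ε hε
    exact div_mul_cancel₀ _ hε.1.ne'
  have hsmall : ∀ᶠ ε in nhdsWithin 0 (Set.Ioi 0), |γ ε| < 1 := by
    have := hγ.abs
    rw [abs_zero] at this
    exact this.eventually_lt_const one_pos
  have hleft : Filter.Tendsto (fun ε => (Real.log (1 - γ ε) + γ ε) / ε ^ 2 + (γ ε / ε) ^ 2 / 2)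
      (nhdsWithin 0 (Set.Ioi 0)) (nhds 0) := by
    have hb : Filter.Tendsto (fun ε => (γ ε / ε) ^ 2 * (|γ ε| / (1 - |γ ε|)))
        (nhdsWithin 0 (Set.Ioi 0)) (nhds 0) := by
      have h1 := hγ.abs
      rw [abs_zero] at h1
      have h2 := (hlim.pow 2).mul (h1.div (h1.const_sub 1) (by norm_num))
      simpa using h2
    refine squeeze_zero_norm' ?_ hb
    filter_upwards [hIoo, hsmall] with ε hε hs
    have hlog := Real.abs_log_sub_add_sum_range_le hs 2
    simp only [Finset.sum_range_succ, Finset.sum_range_zero, zero_add, pow_one, Nat.cast_zero,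
      div_one, Nat.cast_one, Nat.reduceAdd] at hlog
    have e1 : (Real.log (1 - γ ε) + γ ε) / ε ^ 2 + (γ ε / ε) ^ 2 / 2 =
        (γ ε + γ ε ^ 2 / (1 + 1) + Real.log (1 - γ ε)) / ε ^ 2 := by
      have := hε.1.ne'
      field_simp
      ring
    have e2 : (γ ε / ε) ^ 2 * (|γ ε| / (1 - |γ ε|)) = |γ ε| ^ 3 / (1 - |γ ε|) / ε ^ 2 := by
      rw [div_pow, ← sq_abs (γ ε)]
      ring
    rw [e1, e2, Real.norm_eq_abs, abs_div, abs_of_nonneg (sq_nonneg ε)]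
    gcongr
  have hright : Filter.Tendsto (fun ε => (α - γ ε / ε) / (1 - ε) + (γ ε / ε) ^ 2 / 2)
      (nhdsWithin 0 (Set.Ioi 0)) (nhds ((α - M) / (1 - 0) + M ^ 2 / 2)) :=
    ((tendsto_const_nhds.sub hlim).div (tendsto_const_nhds.sub hid) (by norm_num)).add
      ((hlim.pow 2).div_const 2)
  have hcongr : (fun ε => (α - γ ε / ε) / (1 - ε) + (γ ε / ε) ^ 2 / 2) =ᶠ[nhdsWithin 0 (Set.Ioi 0)]
      fun ε => (Real.log (1 - γ ε) + γ ε) / ε ^ 2 + (γ ε / ε) ^ 2 / 2 := by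
    filter_upwards [hIoo] with ε hε
    rw [heq ε hε]
    have h1 := hε.1.ne'
    have h2 : 1 - ε ≠ 0 := by linarith [hε.2]
    field_simp
  have := tendsto_nhds_unique (hright.congr' hcongr) hleft
  rw [sub_zero, div_one] at this
  linarith

namespace FluxMoments

variable {α : ℝ} {m q p y z : ℕ → ℝ} {G g : ℕ → ℝ → ℝ}

/-- Mixing the laws of `X h` and `X (h + 1)` gives laws whose images under the recursion have any
prescribed mean between `m (h + 1)` and `m (h + 2)`; since the second factorial moment increases
under the recursion, such a mean cannot lie between the roots of the quadratic. -/
theorem quadratic_nonneg (F : FluxMoments α m q p y z G g) (h : ℕ) {x : ℝ}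
    (h1 : m (h + 1) ≤ x) (h2 : x ≤ m (h + 2)) (h0 : 0 ≤ m (h + 1)) :
    0 ≤ x ^ 2 - 2 * x + 2 * α := by
  obtain ⟨a, b, ha, hb, hab, hx⟩ : ∃ a b : ℝ, 0 ≤ a ∧ 0 ≤ b ∧ a + b = 1 ∧
      a * m (h + 1) + b * m (h + 2) = x := by
    have : x ∈ segment ℝ (m (h + 1)) (m (h + 2)) := by
      rw [segment_eq_Icc (h1.trans h2)]
      exact ⟨h1, h2⟩
    simpa [segment] using this
  obtain rfl : a = 1 - b := by linarith
  have e1 := F.q_succ h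
  have e2 := F.q_eq h
  have e3 := F.m_succ h
  have e4 := F.q_eq (h + 1)
  have e5 : m (h + 2) = α + y (h + 1) := F.m_succ (h + 1)
  have mq := F.q_mono (Nat.le_succ h)
  have mz := F.z_mono (Nat.le_succ h)
  have hsq : m (h + 1) ^ 2 ≤ x ^ 2 := pow_le_pow_left₀ h0 h1 2
  have k1 : b * z h ≤ b * z (h + 1) := mul_le_mul_of_nonneg_left mz hb
  have k2 : (1 - b) * q h ≤ (1 - b) * q (h + 1) := mul_le_mul_of_nonneg_left mq ha
  have hz : z h = q h - 2 * (m (h + 1) - α) := by linarith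
  have hz' : z (h + 1) = q (h + 1) - 2 * (m (h + 2) - α) := by linarith
  have hxx : (1 - b) * z h + b * z (h + 1) = (1 - b) * q h + b * q (h + 1) - 2 * (x - α) := by
    rw [hz, hz', ← hx]
    ring
  nlinarith

/-- Below criticality the mean never gets over the smaller root. -/
theorem m_le_root (F : FluxMoments α m q p y z G g) (h0 : 0 ≤ α) (hα : α < 1 / 2) (h : ℕ) :
    m (h + 1) ≤ 1 - √(1 - 2 * α) := by
  have hd : 0 < 1 - 2 * α := by linarith
  have hs : 0 < √(1 - 2 * α) := Real.sqrt_pos.2 hd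
  have hs2 : √(1 - 2 * α) ^ 2 = 1 - 2 * α := Real.sq_sqrt hd.le
  induction h with
  | zero =>
    have hm : m (0 + 1) = α := by rw [F.m_succ, F.y_zero, add_zero]
    have : √(1 - 2 * α) ≤ 1 - α := Real.sqrt_le_iff.2 ⟨by linarith, by nlinarith⟩
    linarith
  | succ h ih =>
    by_contra hlt
    rw [not_le] at hlt
    have hpos : 0 ≤ m (h + 1) := by
      rw [← F.m_zero]
      exact F.m_mono (Nat.zero_le _)
    -- a point of the interval strictly between the two roots
    set x := min (m (h + 2)) 1 with hx
    have hx1 : m (h + 1) ≤ x := le_min (F.m_mono (Nat.le_succ _)) (by linarith)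
    have hq := F.quadratic_nonneg h hx1 (min_le_left _ _) hpos
    have hx2 : 1 - √(1 - 2 * α) < x := lt_min hlt (by linarith)
    have hx3 : x ≤ 1 := min_le_right _ _
    nlinarith

theorem p_eq (F : FluxMoments α m q p y z G g) (h : ℕ) : p h = m (h + 1) - m h + (1 - α) := by
  have h1 := F.m_succ h
  have h2 := F.m_add_p h
  linarith

theorem tendsto_p (F : FluxMoments α m q p y z G g) {M : ℝ}
    (hM : Filter.Tendsto m Filter.atTop (nhds M)) :
    Filter.Tendsto p Filter.atTop (nhds (1 - α)) := by
  have h1 := ((Filter.tendsto_add_atTop_iff_nat 1).2 hM).sub hM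
  have h2 := h1.add_const (1 - α)
  rw [sub_self, zero_add] at h2
  exact h2.congr fun h => (F.p_eq h).symm

/-- If the means stay bounded, then their limit solves the quadratic. No second moment of the limit
is needed: the unknown second-order term of its generating function cancels. -/
theorem quadratic_eq_zero (F : FluxMoments α m q p y z G g) {M : ℝ}
    (hM : Filter.Tendsto m Filter.atTop (nhds M)) :
    M ^ 2 - 2 * M + 2 * α = 0 := by
  have hmM : ∀ h, m h ≤ M := fun h => F.m_mono.ge_of_tendsto hM h
  have hGlim : ∀ s ∈ Set.Ioo (0 : ℝ) 1, ∃ Γ,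
      Filter.Tendsto (fun h => G h s) Filter.atTop (nhds Γ) :=
    fun s hs => ⟨_, tendsto_atTop_ciInf (F.G_anti s hs)
      ⟨0, by rintro _ ⟨h, rfl⟩; exact F.G_nonneg h s hs⟩⟩
  choose! Γ hΓ using hGlim
  have hfix : ∀ s ∈ Set.Ioo (0 : ℝ) 1,
      Γ s = Real.exp (α * (s - 1) + ((Γ s + s * (1 - α) - (1 - α)) / s - 1)) := by
    intro s hs
    have hg : Filter.Tendsto (fun h => g h s) Filter.atTop
        (nhds ((Γ s + s * (1 - α) - (1 - α)) / s)) := by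
      have hp := F.tendsto_p hM
      refine ((((hΓ s hs).add (hp.const_mul s)).sub hp).div_const s).congr fun h => ?_
      have := F.G_eq h s hs
      have hs0 := hs.1.ne'
      field_simp
      linarith
    have h1 := (Real.continuous_exp.tendsto _).comp
      ((hg.sub_const 1).const_add (α * (s - 1)))
    refine tendsto_nhds_unique ((Filter.tendsto_add_atTop_iff_nat 1).2 (hΓ s hs))
      (h1.congr fun h => (F.G_succ h s hs).symm)
  have hmem : ∀ ε ∈ Set.Ioo (0 : ℝ) 1, 1 - ε ∈ Set.Ioo (0 : ℝ) 1 := fun ε hε =>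
    ⟨by linarith [hε.2], by linarith [hε.1]⟩
  have hIoo : ∀ᶠ ε : ℝ in nhdsWithin 0 (Set.Ioi 0), ε ∈ Set.Ioo (0 : ℝ) 1 :=
    Ioo_mem_nhdsGT one_pos
  refine quadratic_of_tendsto (γ := fun ε => 1 - Γ (1 - ε)) ?_ ?_
  · intro ε hε
    have h1 := congrArg Real.log (hfix _ (hmem ε hε))
    rw [Real.log_exp] at h1
    rw [sub_sub_cancel, h1]
    have : 1 - ε ≠ 0 := (hmem ε hε).1.ne'
    field_simp
    ring
  · rw [tendsto_order]
    constructor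
    · intro a ha
      obtain ⟨h, hh⟩ := (hM.eventually_const_lt ha).exists
      have hlow : Filter.Tendsto (fun ε : ℝ => m h - q h * ε / 2) (nhdsWithin 0 (Set.Ioi 0))
          (nhds (m h - q h * 0 / 2)) :=
        (((Filter.tendsto_id.mono_left nhdsWithin_le_nhds).const_mul (q h)).div_const 2).const_sub
          (m h)
      rw [mul_zero, zero_div, sub_zero] at hlow
      filter_upwards [hIoo, hlow.eventually_const_lt hh] with ε hε hlt
      refine hlt.trans_le ?_
      have h1 := F.le_one_sub_G h (1 - ε) (hmem ε hε)
      have h2 : Γ (1 - ε) ≤ G h (1 - ε) :=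
        (F.G_anti _ (hmem ε hε)).le_of_tendsto (hΓ _ (hmem ε hε)) h
      rw [le_div_iff₀ hε.1]
      rw [sub_sub_cancel] at h1
      nlinarith
    · intro a ha
      filter_upwards [hIoo] with ε hε
      refine lt_of_le_of_lt ?_ ha
      rw [div_le_iff₀ hε.1]
      refine le_of_tendsto ((hΓ _ (hmem ε hε)).const_sub 1)
        (Filter.Eventually.of_forall fun h => ?_)
      have h1 := F.one_sub_G_le h (1 - ε) (hmem ε hε)
      rw [sub_sub_cancel] at h1
      exact h1.trans (mul_le_mul_of_nonneg_right (hmM h) hε.1.le)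

theorem tendsto_max_div (F : FluxMoments α m q p y z G g) (h0 : 0 ≤ α) :
    Filter.Tendsto (fun h => max 0 (1 - m h) / p h) Filter.atTop
      (nhds (if α ≤ 1 / 2 then √(1 - 2 * α) / (1 - α) else 0)) := by
  rcases tendsto_atTop_of_monotone F.m_mono with htop | ⟨M, hM⟩
  · have hα : 1 / 2 ≤ α := by
      by_contra hlt
      rw [not_le] at hlt
      obtain ⟨h, hh⟩ := (((Filter.tendsto_add_atTop_iff_nat 1).2 htop).eventually_gt_atTop
        (1 - √(1 - 2 * α))).exists
      exact absurd (F.m_le_root h0 hlt h) (not_le.2 hh)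
    have hval : (if α ≤ 1 / 2 then √(1 - 2 * α) / (1 - α) else 0) = 0 := by
      split_ifs with h
      · rw [le_antisymm h hα]
        norm_num
      · rfl
    rw [hval]
    refine tendsto_const_nhds.congr' ?_
    filter_upwards [htop.eventually_ge_atTop 1] with h hh
    rw [max_eq_left (by linarith), zero_div]
  · have hquad := F.quadratic_eq_zero hM
    have hsq : (1 - M) ^ 2 = 1 - 2 * α := by linarith
    have hα : α ≤ 1 / 2 := by nlinarith [sq_nonneg (1 - M)]
    have hpos : 0 ≤ 1 - M := by
      rcases hα.lt_or_eq with hlt | rfl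
      · have : M ≤ 1 - √(1 - 2 * α) := le_of_tendsto ((Filter.tendsto_add_atTop_iff_nat 1).2 hM)
          (Filter.Eventually.of_forall fun h => F.m_le_root h0 hlt h)
        linarith [Real.sqrt_nonneg (1 - 2 * α)]
      · have : (1 - M) ^ 2 = 0 := by linarith
        exact (pow_eq_zero_iff two_ne_zero).1 this |>.ge
    have hroot : √(1 - 2 * α) = max 0 (1 - M) := by
      rw [← hsq, Real.sqrt_sq hpos, max_eq_right hpos]
    rw [if_pos hα, hroot]
    exact (tendsto_const_nhds.max (hM.const_sub 1)).div (F.tendsto_p hM) (by linarith)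

end FluxMoments

/-! ### Moments of the truncated fluxes and the parking probability -/

section Law

variable (ν : Measure ℕ)

theorem lintegral_indicator_singleton_zero :
    ∫⁻ k, ({0} : Set ℕ).indicator 1 k ∂ν = ν {0} :=
  lintegral_indicator_one (measurableSet_singleton 0)

theorem lintegral_natCast_add [IsProbabilityMeasure ν] :
    ∫⁻ k, (k : ℝ≥0∞) ∂ν + ν {0} = ∫⁻ k, ((k - 1 : ℕ) : ℝ≥0∞) ∂ν + 1 := by
  rw [← lintegral_indicator_singleton_zero, ← lintegral_add_left .of_discrete]
  have h1 : (1 : ℝ≥0∞) = ∫⁻ _, 1 ∂ν := by simp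
  rw [h1, ← lintegral_add_left .of_discrete]
  congr 1
  ext k
  cases k <;> simp

theorem lintegral_fallingTwo_eq :
    ∫⁻ k, (fallingTwo k : ℝ≥0∞) ∂ν =
      ∫⁻ k, (fallingTwo (k - 1) : ℝ≥0∞) ∂ν + 2 * ∫⁻ k, ((k - 1 : ℕ) : ℝ≥0∞) ∂ν := by
  rw [← lintegral_const_mul _ .of_discrete, ← lintegral_add_left .of_discrete]
  congr 1
  ext k
  have h : fallingTwo k = fallingTwo (k - 1) + 2 * (k - 1) := by
    rcases k with _ | _ | k
    · rfl
    · rfl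
    · simp only [fallingTwo, Nat.add_sub_cancel]
      ring
  rw [h]
  push_cast
  rfl

theorem lintegral_pow_add (s : ℝ≥0∞) :
    ∫⁻ k, s ^ k ∂ν + s * ν {0} = s * ∫⁻ k, s ^ (k - 1) ∂ν + ν {0} := by
  rw [← lintegral_indicator_singleton_zero, ← lintegral_const_mul _ .of_discrete,
    ← lintegral_const_mul _ .of_discrete, ← lintegral_add_left .of_discrete,
    ← lintegral_add_left .of_discrete]
  congr 1
  ext k
  cases k with
  | zero => simp [add_comm]
  | succ k => simp [pow_succ']

theorem one_le_lintegral_pow_add [IsProbabilityMeasure ν] {s : ℝ} (hs : s ∈ Set.Ioo (0 : ℝ) 1) :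
    1 ≤ ∫⁻ k, ENNReal.ofReal s ^ k ∂ν + ENNReal.ofReal (1 - s) * ∫⁻ k, (k : ℝ≥0∞) ∂ν := by
  have h1 : (1 : ℝ≥0∞) = ∫⁻ _, 1 ∂ν := by simp
  rw [h1, ← lintegral_const_mul _ .of_discrete, ← lintegral_add_left .of_discrete]
  refine lintegral_mono fun k => ?_
  have h0 : 0 ≤ 1 - s := by linarith [hs.2]
  have hpow : 0 ≤ s ^ k := pow_nonneg hs.1.le k
  rw [← ENNReal.ofReal_pow hs.1.le, ← ENNReal.ofReal_natCast, ← ENNReal.ofReal_mul h0,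
    ← ENNReal.ofReal_add hpow (by positivity), ← ENNReal.ofReal_one]
  apply ENNReal.ofReal_le_ofReal
  have := one_add_mul_le_pow (a := s - 1) (by linarith [hs.1]) k
  rw [add_sub_cancel] at this
  linarith

/-- The second-order Bonferroni inequality for `s ^ k = (1 - (1 - s)) ^ k`. -/
theorem pow_add_le {s : ℝ} (hs : s ∈ Set.Ioo (0 : ℝ) 1) (k : ℕ) :
    s ^ k + (1 - s) * k ≤ 1 + (1 - s) ^ 2 / 2 * fallingTwo k := by
  induction k with
  | zero => simp [fallingTwo]
  | succ k ih =>
    have hf : (fallingTwo (k + 1) : ℝ) = fallingTwo k + 2 * k := by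
      have := fallingTwo_add k 1
      rw [this]
      simp [fallingTwo]
    have h1 : s * s ^ k ≤ s * (1 + (1 - s) ^ 2 / 2 * fallingTwo k - (1 - s) * k) :=
      mul_le_mul_of_nonneg_left (by linarith) hs.1.le
    have h2 : 0 ≤ (1 - s) * ((1 - s) ^ 2 / 2 * fallingTwo k) :=
      mul_nonneg (by linarith [hs.2]) (by positivity)
    rw [hf, pow_succ']
    push_cast
    nlinarith

theorem lintegral_pow_add_le [IsProbabilityMeasure ν] {s : ℝ} (hs : s ∈ Set.Ioo (0 : ℝ) 1) :
    ∫⁻ k, ENNReal.ofReal s ^ k ∂ν + ENNReal.ofReal (1 - s) * ∫⁻ k, (k : ℝ≥0∞) ∂ν ≤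
      1 + ENNReal.ofReal ((1 - s) ^ 2 / 2) * ∫⁻ k, (fallingTwo k : ℝ≥0∞) ∂ν := by
  have h1 : (1 : ℝ≥0∞) = ∫⁻ _, 1 ∂ν := by simp
  rw [h1, ← lintegral_const_mul _ .of_discrete, ← lintegral_const_mul _ .of_discrete,
    ← lintegral_add_left .of_discrete, ← lintegral_add_left .of_discrete]
  refine lintegral_mono fun k => ?_
  have h0 : 0 ≤ 1 - s := by linarith [hs.2]
  have hpow : 0 ≤ s ^ k := pow_nonneg hs.1.le k
  rw [← ENNReal.ofReal_pow hs.1.le, ← ENNReal.ofReal_natCast, ← ENNReal.ofReal_mul h0,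
    ← ENNReal.ofReal_add hpow (by positivity), ← ENNReal.ofReal_one, ← ENNReal.ofReal_natCast,
    ← ENNReal.ofReal_mul (by positivity), ← ENNReal.ofReal_add one_pos.le (by positivity)]
  exact ENNReal.ofReal_le_ofReal (pow_add_le hs k)

theorem lintegral_pow_le_one [IsProbabilityMeasure ν] {s : ℝ} (hs : s ≤ 1) (f : ℕ → ℕ) :
    ∫⁻ k, ENNReal.ofReal s ^ f k ∂ν ≤ 1 := by
  calc ∫⁻ k, ENNReal.ofReal s ^ f k ∂ν ≤ ∫⁻ _, 1 ∂ν :=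
        lintegral_mono fun k => pow_le_one₀ (zero_le) (ENNReal.ofReal_le_one.2 hs)
    _ = 1 := by simp

theorem lintegral_pred_le :
    ∫⁻ k, ((k - 1 : ℕ) : ℝ≥0∞) ∂ν ≤ ∫⁻ k, (k : ℝ≥0∞) ∂ν :=
  lintegral_mono fun k => Nat.mono_cast (Nat.sub_le k 1)

theorem fallingTwo_mono : Monotone fallingTwo := fun _ _ h =>
  Nat.mul_le_mul h (Nat.sub_le_sub_right h 1)

theorem lintegral_fallingTwo_pred_le :
    ∫⁻ k, (fallingTwo (k - 1) : ℝ≥0∞) ∂ν ≤ ∫⁻ k, (fallingTwo k : ℝ≥0∞) ∂ν :=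
  lintegral_mono fun k => Nat.mono_cast (fallingTwo_mono (Nat.sub_le k 1))

end Law

namespace IsPoissonField

variable {Ω : Type*} [MeasurableSpace Ω] {μ : Measure Ω} {α : ℝ≥0} {N P : List ℕ → Ω → ℕ}

theorem isCompound (F : IsPoissonField μ α N P) (h : ℕ) : IsCompound μ α (rootData N P h) where
  measurable := F.measurable_rootData h
  indep := F.iIndepFun_rootData h
  map_zero := F.map_left []
  map_one := F.map_right []
  map_add_two i := by
    have hpred : Measurable fun k : ℕ => k - 1 := .of_discrete
    have hmap : ∀ j, μ.map (rootData N P h (j + 2)) =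
        (μ.map (fun ω => flux (fun w => N w ω) (fun w => P w ω) h [])).map (fun k => k - 1) := by
      intro j
      rw [← F.map_flux_singleton h j,
        Measure.map_map hpred (measurable_flux F.measurable_left F.measurable_right h [j])]
      rfl
    rw [hmap i, hmap 0]

/-- The law of the flux truncated at height `h`. -/
noncomputable def fluxLaw (μ : Measure Ω) (N P : List ℕ → Ω → ℕ) (h : ℕ) : Measure ℕ :=
  μ.map (fun ω => flux (fun w => N w ω) (fun w => P w ω) h [])

theorem measurable_root (F : IsPoissonField μ α N P) (h : ℕ) :
    Measurable fun ω => flux (fun w => N w ω) (fun w => P w ω) h [] :=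
  measurable_flux F.measurable_left F.measurable_right h []

theorem isProbabilityMeasure_fluxLaw (F : IsPoissonField μ α N P) (h : ℕ) :
    IsProbabilityMeasure (fluxLaw μ N P h) := by
  have := F.indep.isProbabilityMeasure
  exact Measure.isProbabilityMeasure_map (F.measurable_root h).aemeasurable

theorem lintegral_fluxLaw (F : IsPoissonField μ α N P) (h : ℕ) (f : ℕ → ℝ≥0∞) :
    ∫⁻ k, f k ∂fluxLaw μ N P h = ∫⁻ ω, f (flux (fun w => N w ω) (fun w => P w ω) h []) ∂μ :=
  lintegral_map .of_discrete (F.measurable_root h)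

theorem lintegral_rootData_two (F : IsPoissonField μ α N P) (h : ℕ) (f : ℕ → ℝ≥0∞) :
    ∫⁻ ω, f (rootData N P h 2 ω) ∂μ = ∫⁻ k, f (k - 1) ∂fluxLaw μ N P h := by
  rw [fluxLaw, ← F.map_flux_singleton h 0, lintegral_map .of_discrete
    (measurable_flux F.measurable_left F.measurable_right h [0])]
  rfl

theorem lintegral_fluxLaw_succ (F : IsPoissonField μ α N P) (h : ℕ) (f : ℕ → ℝ≥0∞) :
    ∫⁻ k, f k ∂fluxLaw μ N P (h + 1) =
      ∫⁻ ω, f (partialSum (rootData N P h) (rootData N P h 0 ω) ω) ∂μ :=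
  F.lintegral_fluxLaw (h + 1) f

theorem mean_succ (F : IsPoissonField μ α N P) (h : ℕ) :
    ∫⁻ k, (k : ℝ≥0∞) ∂fluxLaw μ N P (h + 1) =
      α + ∫⁻ k, ((k - 1 : ℕ) : ℝ≥0∞) ∂fluxLaw μ N P h := by
  rw [F.lintegral_fluxLaw_succ h (fun k => (k : ℝ≥0∞)), (F.isCompound h).lintegral_natCast_compound,
    F.lintegral_rootData_two h (fun k => (k : ℝ≥0∞))]

theorem fallingTwo_succ (F : IsPoissonField μ α N P) (h : ℕ) :
    ∫⁻ k, (fallingTwo k : ℝ≥0∞) ∂fluxLaw μ N P (h + 1) =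
      (∫⁻ k, (k : ℝ≥0∞) ∂fluxLaw μ N P (h + 1)) ^ 2 +
        ∫⁻ k, (fallingTwo (k - 1) : ℝ≥0∞) ∂fluxLaw μ N P h := by
  rw [F.lintegral_fluxLaw_succ h (fun k => (fallingTwo k : ℝ≥0∞)),
    (F.isCompound h).lintegral_fallingTwo_compound,
    F.lintegral_rootData_two h (fun k => (fallingTwo k : ℝ≥0∞)),
    F.lintegral_fluxLaw_succ h (fun k => (k : ℝ≥0∞))]

theorem pow_succ (F : IsPoissonField μ α N P) (h : ℕ) {s : ℝ} (hs : 0 ≤ s) (hs1 : s ≤ 1) :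
    ∫⁻ k, ENNReal.ofReal s ^ k ∂fluxLaw μ N P (h + 1) = ENNReal.ofReal (Real.exp (α * (s - 1) +
      ((∫⁻ k, ENNReal.ofReal s ^ (k - 1) ∂fluxLaw μ N P h).toReal - 1))) := by
  have := F.isProbabilityMeasure_fluxLaw h
  rw [F.lintegral_fluxLaw_succ h (fun k => ENNReal.ofReal s ^ k)]
  refine (F.isCompound h).lintegral_pow_compound hs ENNReal.toReal_nonneg ?_
  rw [F.lintegral_rootData_two h (fun k => ENNReal.ofReal s ^ k), ENNReal.ofReal_toReal]
  exact ((lintegral_pow_le_one _ hs1 (fun k => k - 1)).trans_lt ENNReal.one_lt_top).ne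

theorem fluxLaw_singleton_zero_pos (F : IsPoissonField μ α N P) (h : ℕ) :
    0 < fluxLaw μ N P h {0} := by
  have := F.isProbabilityMeasure_fluxLaw h
  -- the generating function at `0`, where `0 ^ 0 = 1`
  have h0 : ∫⁻ k, ENNReal.ofReal 0 ^ k ∂fluxLaw μ N P h = fluxLaw μ N P h {0} := by
    rw [← lintegral_indicator_singleton_zero]
    congr 1
    ext k
    cases k <;> simp
  rw [← h0]
  cases h with
  | zero =>
    rw [F.lintegral_fluxLaw 0 (fun k => ENNReal.ofReal 0 ^ k)]
    have := F.indep.isProbabilityMeasure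
    simp [flux]
  | succ h =>
    rw [F.pow_succ h le_rfl zero_le_one]
    exact ENNReal.ofReal_pos.2 (Real.exp_pos _)

theorem lintegral_fluxLaw_mono (F : IsPoissonField μ α N P) {f : ℕ → ℝ≥0∞} (hf : Monotone f) :
    Monotone fun h => ∫⁻ k, f k ∂fluxLaw μ N P h := by
  refine monotone_nat_of_le_succ fun h => ?_
  rw [F.lintegral_fluxLaw, F.lintegral_fluxLaw]
  exact lintegral_mono fun ω => hf (flux_le_flux_succ _ _ _ _)

theorem lintegral_fluxLaw_anti (F : IsPoissonField μ α N P) {f : ℕ → ℝ≥0∞} (hf : Antitone f) :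
    Antitone fun h => ∫⁻ k, f k ∂fluxLaw μ N P h := by
  refine antitone_nat_of_succ_le fun h => ?_
  rw [F.lintegral_fluxLaw, F.lintegral_fluxLaw]
  exact lintegral_mono fun ω => hf (flux_le_flux_succ _ _ _ _)

theorem mean_ne_top (F : IsPoissonField μ α N P) (h : ℕ) :
    ∫⁻ k, (k : ℝ≥0∞) ∂fluxLaw μ N P h ≠ ∞ := by
  induction h with
  | zero =>
    rw [F.lintegral_fluxLaw 0 (fun k => (k : ℝ≥0∞))]
    simp [flux]
  | succ h ih =>
    rw [F.mean_succ]
    exact ENNReal.add_ne_top.2 ⟨ENNReal.coe_ne_top, ne_top_of_le_ne_top ih (lintegral_pred_le _)⟩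

theorem fallingTwo_ne_top (F : IsPoissonField μ α N P) (h : ℕ) :
    ∫⁻ k, (fallingTwo k : ℝ≥0∞) ∂fluxLaw μ N P h ≠ ∞ := by
  induction h with
  | zero =>
    rw [F.lintegral_fluxLaw 0 (fun k => (fallingTwo k : ℝ≥0∞))]
    simp [flux, fallingTwo]
  | succ h ih =>
    rw [F.fallingTwo_succ]
    exact ENNReal.add_ne_top.2 ⟨ENNReal.pow_ne_top (F.mean_ne_top _),
      ne_top_of_le_ne_top ih (lintegral_fallingTwo_pred_le _)⟩

/-- The truncated fluxes of a Poisson family tree satisfy the relations of `FluxMoments`. -/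
theorem fluxMoments (F : IsPoissonField μ α N P) :
    FluxMoments α (fun h => (∫⁻ k, (k : ℝ≥0∞) ∂fluxLaw μ N P h).toReal)
      (fun h => (∫⁻ k, (fallingTwo k : ℝ≥0∞) ∂fluxLaw μ N P h).toReal)
      (fun h => (fluxLaw μ N P h).real {0})
      (fun h => (∫⁻ k, ((k - 1 : ℕ) : ℝ≥0∞) ∂fluxLaw μ N P h).toReal)
      (fun h => (∫⁻ k, (fallingTwo (k - 1) : ℝ≥0∞) ∂fluxLaw μ N P h).toReal)
      (fun h s => (∫⁻ k, ENNReal.ofReal s ^ k ∂fluxLaw μ N P h).toReal)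
      (fun h s => (∫⁻ k, ENNReal.ofReal s ^ (k - 1) ∂fluxLaw μ N P h).toReal) := by
  have hprob := F.isProbabilityMeasure_fluxLaw
  have hm := F.mean_ne_top
  have hq := F.fallingTwo_ne_top
  have hy : ∀ h, ∫⁻ k, ((k - 1 : ℕ) : ℝ≥0∞) ∂fluxLaw μ N P h ≠ ∞ := fun h =>
    ne_top_of_le_ne_top (hm h) (lintegral_pred_le _)
  have hz : ∀ h, ∫⁻ k, (fallingTwo (k - 1) : ℝ≥0∞) ∂fluxLaw μ N P h ≠ ∞ := fun h =>
    ne_top_of_le_ne_top (hq h) (lintegral_fallingTwo_pred_le _)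
  have hG : ∀ h, ∀ s ∈ Set.Ioo (0 : ℝ) 1, ∀ f : ℕ → ℕ,
      ∫⁻ k, ENNReal.ofReal s ^ f k ∂fluxLaw μ N P h ≠ ∞ := fun h s hs f =>
    ((lintegral_pow_le_one _ hs.2.le f).trans_lt ENNReal.one_lt_top).ne
  have hp : ∀ h, fluxLaw μ N P h {0} ≠ ∞ := fun h => measure_ne_top _ _
  have hcast : Monotone fun k : ℕ => (k : ℝ≥0∞) := Nat.mono_cast
  refine
    { m_zero := ?_, m_succ := ?_, m_add_p := ?_, q_eq := ?_, q_succ := ?_, m_mono := ?_,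
      q_mono := ?_, z_mono := ?_, y_zero := ?_, G_eq := ?_, G_succ := ?_,
      G_nonneg := fun _ _ _ => ENNReal.toReal_nonneg, G_anti := ?_, one_sub_G_le := ?_,
      le_one_sub_G := ?_ }
  · rw [F.lintegral_fluxLaw 0 (fun k => (k : ℝ≥0∞))]
    simp [flux]
  · intro h
    rw [F.mean_succ, ENNReal.toReal_add ENNReal.coe_ne_top (hy h), ENNReal.coe_toReal]
  · intro h
    rw [measureReal_def, ← ENNReal.toReal_add (hm h) (hp h), lintegral_natCast_add,
      ENNReal.toReal_add (hy h) ENNReal.one_ne_top, ENNReal.toReal_one]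
  · intro h
    rw [lintegral_fallingTwo_eq, ENNReal.toReal_add (hz h)
      (ENNReal.mul_ne_top ENNReal.ofNat_ne_top (hy h)), ENNReal.toReal_mul, ENNReal.toReal_ofNat]
  · intro h
    rw [F.fallingTwo_succ, ENNReal.toReal_add (ENNReal.pow_ne_top (hm _)) (hz h),
      ENNReal.toReal_pow]
  · exact fun a b hab => ENNReal.toReal_mono (hm b) (F.lintegral_fluxLaw_mono hcast hab)
  · exact fun a b hab => ENNReal.toReal_mono (hq b)
      (F.lintegral_fluxLaw_mono (hcast.comp fallingTwo_mono) hab)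
  · exact fun a b hab => ENNReal.toReal_mono (hz b) (F.lintegral_fluxLaw_mono
      (hcast.comp (fallingTwo_mono.comp fun _ _ h => Nat.sub_le_sub_right h 1)) hab)
  · rw [F.lintegral_fluxLaw 0 (fun k => ((k - 1 : ℕ) : ℝ≥0∞))]
    simp [flux]
  · intro h s hs
    have e := congrArg ENNReal.toReal (lintegral_pow_add (fluxLaw μ N P h) (ENNReal.ofReal s))
    rwa [ENNReal.toReal_add (hG h s hs fun k => k)
        (ENNReal.mul_ne_top ENNReal.ofReal_ne_top (hp h)),
      ENNReal.toReal_add (ENNReal.mul_ne_top ENNReal.ofReal_ne_top (hG h s hs fun k => k - 1))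
        (hp h),
      ENNReal.toReal_mul, ENNReal.toReal_mul, ENNReal.toReal_ofReal hs.1.le] at e
  · intro h s hs
    rw [F.pow_succ h hs.1.le hs.2.le, ENNReal.toReal_ofReal (Real.exp_pos _).le]
  · intro s hs a b hab
    refine ENNReal.toReal_mono (hG a s hs fun k => k) (F.lintegral_fluxLaw_anti ?_ hab)
    exact fun i j hij => pow_le_pow_of_le_one zero_le (ENNReal.ofReal_le_one.2 hs.2.le) hij
  · intro h s hs
    have h0 : 0 ≤ 1 - s := by linarith [hs.2]
    have hmul := ENNReal.mul_ne_top (ENNReal.ofReal_ne_top (r := 1 - s)) (hm h)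
    have e := ENNReal.toReal_mono (ENNReal.add_ne_top.2 ⟨hG h s hs fun k => k, hmul⟩)
      (one_le_lintegral_pow_add (fluxLaw μ N P h) hs)
    rw [ENNReal.toReal_add (hG h s hs fun k => k) hmul, ENNReal.toReal_mul,
      ENNReal.toReal_ofReal h0, ENNReal.toReal_one] at e
    linarith
  · intro h s hs
    have h0 : 0 ≤ 1 - s := by linarith [hs.2]
    have hmul := ENNReal.mul_ne_top (ENNReal.ofReal_ne_top (r := 1 - s)) (hm h)
    have hmul' := ENNReal.mul_ne_top (ENNReal.ofReal_ne_top (r := (1 - s) ^ 2 / 2)) (hq h)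
    have e := ENNReal.toReal_mono (ENNReal.add_ne_top.2 ⟨ENNReal.one_ne_top, hmul'⟩)
      (lintegral_pow_add_le (fluxLaw μ N P h) hs)
    rw [ENNReal.toReal_add (hG h s hs fun k => k) hmul, ENNReal.toReal_mul,
      ENNReal.toReal_ofReal h0, ENNReal.toReal_add ENNReal.one_ne_top hmul', ENNReal.toReal_one,
      ENNReal.toReal_mul, ENNReal.toReal_ofReal (by positivity)] at e
    linarith

end IsPoissonField
end SpineParking

theorem theorem3 {Ω : Type*} [MeasurableSpace Ω] (μ : Measure Ω) [IsProbabilityMeasure μ]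
    (α : ℝ≥0)
    (N P : SpineParking.Vertex → Ω → ℕ)
    (hN : ∀ v, Measurable (N v)) (hP : ∀ v, Measurable (P v))
    (hNlaw : ∀ v, μ.map (N v) = poissonMeasure 1)
    (hPlaw : ∀ v, μ.map (P v) = poissonMeasure α)
    (hindep : iIndepFun (Sum.elim N P) μ) :
    MeasurableSet {ω | SpineParking.AllCarsPark (fun v => N v ω) (fun v => P v ω)} ∧
    μ {ω | SpineParking.AllCarsPark (fun v => N v ω) (fun v => P v ω)} =
      ENNReal.ofReal (if (α : ℝ) ≤ 1 / 2 then √(1 - 2 * (α : ℝ)) / (1 - (α : ℝ)) else 0) := by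
  have F : SpineParking.IsPoissonField μ α N P := ⟨hN, hP, hNlaw, hPlaw, hindep⟩
  have Fk : ∀ k : ℕ, SpineParking.IsPoissonField μ α (fun w => N (k, w)) (fun w => P (k, w)) :=
    fun k => F.precomp (e := fun w => (k, w)) fun _ _ h => (Prod.mk.inj h).2
  let X : ℕ → ℕ → Ω → ℕ := fun h k ω =>
    SpineParking.flux (fun w => N (k, w) ω) (fun w => P (k, w) ω) h []
  have hX : ∀ h k, Measurable (X h k) := fun h k => (Fk k).measurable_root h
  let A : ℕ → Set Ω := fun h => {ω | (fun k => X h k ω) ∈ SpineParking.stayBelow 0}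
  have hA : ∀ h, MeasurableSet (A h) := fun h =>
    (measurable_pi_iff.2 (hX h)) (SpineParking.measurableSet_stayBelow 0)
  have hevent : {ω | SpineParking.AllCarsPark (fun v => N v ω) (fun v => P v ω)} = ⋂ h, A h := by
    ext ω
    rw [Set.mem_iInter]
    exact SpineParking.allCarsPark_iff_flux _ _
  -- a larger truncation height lets more cars through
  have hanti : Antitone A := antitone_nat_of_succ_le fun h ω hω n =>
    (Finset.sum_le_sum fun k _ => SpineParking.flux_le_flux_succ _ _ h []).trans (hω n)
  have hlim : Filter.Tendsto (fun h => μ (A h)) Filter.atTop (nhds (μ (⋂ h, A h))) :=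
    tendsto_measure_iInter_atTop (fun h => (hA h).nullMeasurableSet) hanti ⟨0, measure_ne_top _ _⟩
  have hval : ∀ h, μ (A h) = ENNReal.ofReal
      (max 0 (1 - (∫⁻ k, (k : ℝ≥0∞) ∂SpineParking.IsPoissonField.fluxLaw μ (fun w => N (0, w))
        (fun w => P (0, w)) h).toReal) /
      (SpineParking.IsPoissonField.fluxLaw μ (fun w => N (0, w))
        (fun w => P (0, w)) h).real {0}) := by
    intro h
    have hmean := (Fk 0).lintegral_fluxLaw h (fun k => (k : ℝ≥0∞))
    have hwalk := SpineParking.measureReal_stayBelow_zero (hX h) (F.iIndepFun_spine h)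
      (fun k => (Fk k).map_flux_eq (Fk 0) h) (hmean ▸ (Fk 0).mean_ne_top h)
    have hp : (SpineParking.IsPoissonField.fluxLaw μ (fun w => N (0, w))
        (fun w => P (0, w)) h).real {0} = μ.real {ω | X h 0 ω = 0} := by
      rw [measureReal_def, SpineParking.IsPoissonField.fluxLaw,
        Measure.map_apply (hX h 0) (measurableSet_singleton 0)]
      rfl
    have hp0 : 0 < μ.real {ω | X h 0 ω = 0} := by
      have := (Fk 0).isProbabilityMeasure_fluxLaw h
      rw [← hp]
      exact ENNReal.toReal_pos ((Fk 0).fluxLaw_singleton_zero_pos h).ne' (measure_ne_top _ _)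
    rw [hp, hmean, ← hwalk, mul_div_cancel_left₀ _ hp0.ne', ofReal_measureReal]
  rw [hevent]
  refine ⟨MeasurableSet.iInter hA, ?_⟩
  refine tendsto_nhds_unique hlim ?_
  simp_rw [hval]
  exact (ENNReal.continuous_ofReal.tendsto _).comp ((Fk 0).fluxMoments.tendsto_max_div α.coe_nonneg)
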